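/- Let $\Bbbk$ be a field, $Q=\Bbbk[x_1,\dots,x_n]$ with its $\mathbb N^n$-grading, and let $\phi\colon E\to G$ be a multigraded (degree-preserving) $Q$-linear map of finite free multigraded $Q$-modules with homogeneous bases $e_1,\dots,e_e$ of $E$ and $g_1,\dots,g_g$ of $G$. Put $r=\operatorname{rank}\phi$. The matrix of $\phi$ has entries $c_{ij}x^{|e_j|-|g_i|}$ with $c_{ij}\in\Bbbk$ (and $c_{ij}=0$ unless $|g_i|\preceq|e_j|$); let $C=(c_{ij})$ be the coefficient matrix, $s\colon U=\Bbbk^e\to W=\Bbbk^g$ the linear map with matrix $C$ (the basis of $U$ is again written $e_1,\dots,e_e$), $V=\operatorname{im}(s)$, $V^*=\operatorname{Hom}_\Bbbk(V,\Bbbk)$ and $D_pV^*=(S_pV)^*$. For $\mathbf a\in\mathbb N^n$ let $C_{\mathbf a}$ be the submatrix of $C$ on the columns $j$ with $|e_j|\preceq\mathbf a$. For $I\subseteq\{1,\dots,e\}$ put $e_I=\bigwedge_{i\in I}e_i$ (in increasing order), $|e_I|=\operatorname{lcm}(|e_i| : i\in I)$, and for $l\in I$ let $\operatorname{sgn}(l,I\setminus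 l)=(-1)^{\#\{j\in I\,:\,j<l\}}$. The Taylor complex $T_\bullet(\phi)$ (the Buchsbaum–Rim–Taylor complex of the full system $F_I=D_{|I|-r-1}V^*$ for $|I|\ge r+1$, $F_I=0$ otherwise) has $T_0=G$, $T_1=E$, $\phi_1=\phi$, and for $i\ge2$ $$T_i=\bigoplus_{|I|=r+i-1}Q\otimes_\Bbbk D_{i-2}V^*\otimes_\Bbbk \Bbbk e_I\otimes_\Bbbk\textstyle\bigwedge^rV^* .$$ Its differentials are the homogenizations of those of the Buchsbaum–Rim complex of $s$: for $y\in Q$, $f\in D_{i-2}V^*$, $\omega\in\bigwedge^rV^*$, $$\phi_i(y\otimes f\otimes e_I\otimes\omega)=\sum_{l\in I}\operatorname{sgn}(l,I\setminus l)\,x^{|e_I|-|e_{I\setminus l}|}y\otimes (s(e_l)\lrcorner f)\otimes e_{I\setminus l}\otimes\omega\qquad(i\ge3),$$ where $(v\lrcorner f)(w)=f(vw)$ for $v\in V$, $w\in S_{i-3}V$, and, identifying $D_0V^*=\Bbbk$, $$\phi_2(y\otimes f\otimes e_J\otimes\omega)=\sum_{l\in J}\operatorname{sgn}(l,J\setminus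 l)\,x^{|e_J|-|e_l|}\,y\,f\,\bigl\langle \textstyle\bigwedge^r s\,(e_{J\setminus l}),\omega\bigr\rangle\,e_l ,$$ where $\langle\,,\rangle$ is the canonical pairing of $\bigwedge^rV$ with $\bigwedge^rV^*$. **Theorem.** $T_\bullet(\phi)$ is a complex, and it is exact (that is, $H_i(T_\bullet(\phi))=0$ for all $i\ne0$) if and only if for every multidegree $\mathbf a\in\mathbb N^n$ the matrix $C_{\mathbf a}$ has maximal rank, meaning $$\operatorname{rank}C_{\mathbf a}=\min\bigl(r,\ \#\{j : |e_j|\preceq\mathbf a\}\bigr).$$ -/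

import Mathlib

open scoped TensorProduct

noncomputable section

namespace BRT

universe u v w

/-! ### Finite free multigraded modules and multigraded maps -/

/-- The polynomial ring `K[x₁,…,xₙ]`. -/
abbrev Poly (K : Type u) [CommRing K] (n : ℕ) : Type u := MvPolynomial (Fin n) K

/-- A finite free multigraded module over `K[x₁,…,xₙ]`: the module `E` together with a (finite)
homogeneous basis `basis 0, …, basis (e-1)`, the element `basis j` having multidegree
`deg j ∈ ℕⁿ`.  These data determine the multigrading of `E`, see `FreeMultigraded.component`. -/
structure FreeMultigraded (K : Type u) [CommRing K] (n e : ℕ) (E : Type v) [AddCommGroup E]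
    [Module (Poly K n) E] where
  basis : Module.Basis (Fin e) (Poly K n) E
  deg : Fin e → (Fin n →₀ ℕ)

/-- The set of elements of multidegree `a` of a free multigraded module: the `K`-span of the
elements `x^ν • basis j` with `ν + deg j = a`, described through coordinates. -/
def FreeMultigraded.component {K : Type u} [CommRing K] {n e : ℕ} {E : Type v} [AddCommGroup E]
    [Module (Poly K n) E] (bE : FreeMultigraded K n e E) (a : Fin n →₀ ℕ) : Set E :=
  {z | ∀ j, ∀ ν ∈ (bE.basis.repr z j).support, ν + bE.deg j = a}

/-- A `K[x₁,…,xₙ]`-linear map is multigraded if it preserves multidegrees. -/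
def IsMultigraded {K : Type u} [CommRing K] {n e g : ℕ} {E : Type v} [AddCommGroup E]
    [Module (Poly K n) E] {G : Type w} [AddCommGroup G] [Module (Poly K n) G]
    (bE : FreeMultigraded K n e E) (bG : FreeMultigraded K n g G)
    (φ : E →ₗ[Poly K n] G) : Prop :=
  ∀ a, ∀ z ∈ bE.component a, φ z ∈ bG.component a

/-- The coefficient matrix `C = (c i j)` of a multigraded map: the `(i,j)` entry of the matrix of
`φ` has the form `c i j * x^(deg (e j) - deg (g i))`. -/
def coeffMatrix {K : Type u} [CommRing K] {n e g : ℕ} {E : Type v} [AddCommGroup E]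
    [Module (Poly K n) E] {G : Type w} [AddCommGroup G] [Module (Poly K n) G]
    (bE : FreeMultigraded K n e E) (bG : FreeMultigraded K n g G)
    (φ : E →ₗ[Poly K n] G) : Matrix (Fin g) (Fin e) K :=
  Matrix.of fun i j => (bG.basis.repr (φ (bE.basis j)) i).coeff (bE.deg j - bG.deg i)

/-- The rank of a linear map between finite free modules over a domain. -/
def mapRank {K : Type u} [CommRing K] {n : ℕ} {E : Type v} [AddCommGroup E]
    [Module (Poly K n) E] {G : Type w} [AddCommGroup G] [Module (Poly K n) G]
    (φ : E →ₗ[Poly K n] G) : ℕ :=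
  Module.finrank (Poly K n) (LinearMap.range φ)

/-- The submatrix `C_a` of the coefficient matrix on the columns of degree `≤ a`. -/
def coeffMatrixLE {K : Type u} [CommRing K] {n e g : ℕ} {E : Type v} [AddCommGroup E]
    [Module (Poly K n) E] {G : Type w} [AddCommGroup G] [Module (Poly K n) G]
    (bE : FreeMultigraded K n e E) (bG : FreeMultigraded K n g G)
    (φ : E →ₗ[Poly K n] G) (a : Fin n →₀ ℕ) : Matrix (Fin g) {j : Fin e // bE.deg j ≤ a} K :=
  (coeffMatrix bE bG φ).submatrix id Subtype.val

/-! ### Multilinear algebra -/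

section Multilinear

variable (K : Type u) [Field K] (V : Type v) [AddCommGroup V] [Module K V]

/-- The symmetric power `S_p V`: the degree `p` part of the symmetric algebra of `V`. -/
abbrev SymPow (p : ℕ) : Submodule K (SymmetricAlgebra K V) :=
  LinearMap.range (SymmetricAlgebra.ι K V) ^ p

/-- The divided power `D_p V* = (S_p V)*`. -/
abbrev DivPow (p : ℕ) : Type (max u v) := Module.Dual K (SymPow K V p)

/-- The exterior power `⋀^r V*`. -/
abbrev ExtDual (r : ℕ) : Type (max u v) := ⋀[K]^r (Module.Dual K V)

variable {K V}

/-- Multiplication by `v ∈ V` on the symmetric algebra, `S_p V → S_{p+1} V`. -/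
def symMul (p : ℕ) (v : V) : SymPow K V p →ₗ[K] SymPow K V (p + 1) :=
  (LinearMap.mulLeft K (SymmetricAlgebra.ι K V v)).restrict fun x hx => by
    rw [SymPow, LinearMap.mulLeft_apply, pow_succ']
    exact Submodule.mul_mem_mul (LinearMap.mem_range_self _ v) hx

/-- Contraction with `v ∈ V`: the composition `D_{p+1} V* → D_p V* ⊗ V* → D_p V*` of the diagonal
with evaluation at `v`.  It is the transpose of multiplication by `v`, and sends a divided power
monomial `υ^(b)` to `∑ j, υ_j(v) υ^(b - e_j)`. -/
def contract (p : ℕ) (v : V) : DivPow K V (p + 1) →ₗ[K] DivPow K V p :=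
  Module.Dual.transpose (symMul p v)

/-- The identification `D_0 V* = K`: evaluation at `1 ∈ S_0 V`. -/
def divPowZero : DivPow K V 0 →ₗ[K] K :=
  LinearMap.applyₗ (⟨1, by rw [SymPow, pow_zero]; exact Submodule.one_le.mp le_rfl⟩ : SymPow K V 0)

/-- The faces with `m` elements of the full simplex on the vertices `0, …, e-1`. -/
abbrev Face (e m : ℕ) : Type := {I : Finset (Fin e) // I.card = m}

/-- `sgn(l, I \ l)` for `l ∈ I`. -/
def sgn {e : ℕ} (I : Finset (Fin e)) (l : Fin e) : K := (-1) ^ (I.filter (· < l)).card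

variable {e : ℕ}

/-- The component `D_{p+1} V* ⊗ e_I → D_p V* ⊗ e_J` of the Koszul type differential
`f ⊗ e_I ↦ ∑_{l ∈ I} sgn(l, I \ l) (s(e_l) ⌟ f) ⊗ e_{I \ l}` attached to `s : U → V`, where `U` has
the basis `e_0, …, e_{e-1}`. -/
def koszulComp (s : (Fin e → K) →ₗ[K] V) (p : ℕ) (I J : Finset (Fin e)) :
    DivPow K V (p + 1) →ₗ[K] DivPow K V p :=
  ∑ l ∈ I, if I.erase l = J then sgn (K := K) I l • contract p (s (Pi.single l 1)) else 0

/-- For `J = {j_0 < … < j_r}` and `l = j_t`, the functional on `D_0 V* ⊗ ⋀^r V*` giving the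
coefficient of `e_l` in the splice map `s_2`:
`f ⊗ ω ↦ f(1) sgn(l, J \ l) ⟨s(e_{J \ l}), ω⟩`, where `e_{J \ l} ∈ ⋀^r U`. -/
def spliceComp (s : (Fin e → K) →ₗ[K] V) {r : ℕ} (J : Face e (r + 1)) (t : Fin (r + 1)) :
    DivPow K V 0 ⊗[K] ExtDual K V r →ₗ[K] K :=
  sgn (K := K) J.1 (J.1.orderEmbOfFin J.2 t) •
    (LinearMap.mul' K K ∘ₗ TensorProduct.map divPowZero
      (LinearMap.applyₗ (exteriorPower.ιMulti K r fun i : Fin r =>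
          s (Pi.single (J.1.orderEmbOfFin J.2 (t.succAbove i)) 1)) ∘ₗ
        exteriorPower.pairingDual K V r))

/-! ### BRT systems -/

/-- A Buchsbaum–Rim–Taylor system for `s : U → V` (with `r` the rank): a subspace
`F_I ⊆ D_{|I|-r-1} V*` for every `I` with `|I| ≥ r + 1` (here `F p I` is `F_I` for
`|I| = r + 1 + p`, and `F_I = 0` is understood for `|I| ≤ r`), compatible with the differentials of
the Buchsbaum–Rim complex. -/
structure System (s : (Fin e → K) →ₗ[K] V) (r : ℕ) where
  F : ∀ p : ℕ, Face e (r + 1 + p) → Submodule K (DivPow K V p)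
  compat : ∀ (p : ℕ) (I : Face e (r + 1 + (p + 1))) (J : Face e (r + 1 + p)),
    ∀ f ∈ F (p + 1) I, koszulComp s p I.1 J.1 f ∈ F p J

/-- The full BRT system: `F_I = D_{|I|-r-1} V*` for `|I| ≥ r + 1`. -/
def fullSystem (s : (Fin e → K) →ₗ[K] V) (r : ℕ) : System s r where
  F _ _ := ⊤
  compat _ _ _ _ _ := Submodule.mem_top

end Multilinear

/-! ### The BRT complex -/

section Complex

variable {K : Type u} [Field K] {n e : ℕ} {V : Type v} [AddCommGroup V] [Module K V]
  {s : (Fin e → K) →ₗ[K] V} {r : ℕ}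

/-- The term `R_{p+2} = ⨁_{|I| = r+1+p} Q ⊗ F_I ⊗ e_I ⊗ ⋀^r V*` of the BRT complex
(a finite direct sum, written as a product). -/
abbrev System.Term (n : ℕ) (𝔽 : System s r) (p : ℕ) : Type (max u v) :=
  ∀ I : Face e (r + 1 + p), Poly K n ⊗[K] (𝔽.F p I ⊗[K] ExtDual K V r)

/-- The component `s_{p+3}^{I,J} : F_I ⊗ e_I ⊗ ⋀^r V* → F_J ⊗ e_J ⊗ ⋀^r V*` of the differential
of the Buchsbaum–Rim complex. -/
def System.comp (𝔽 : System s r) (p : ℕ) (I : Face e (r + 1 + (p + 1))) (J : Face e (r + 1 + p)) :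
    𝔽.F (p + 1) I ⊗[K] ExtDual K V r →ₗ[K] 𝔽.F p J ⊗[K] ExtDual K V r :=
  ((koszulComp s p I.1 J.1).restrict (𝔽.compat p I J)).rTensor _

/-- The multidegree `|e_I| = lcm (|e_i| : i ∈ I)`. -/
def faceDeg (deg : Fin e → (Fin n →₀ ℕ)) (I : Finset (Fin e)) : Fin n →₀ ℕ := I.sup deg

/-- The differential `φ_{p+3} : R_{p+3} → R_{p+2}` of the BRT complex, with components
`y ⊗ z ↦ x^(|e_I| - |e_J|) y ⊗ s_{p+3}^{I,J}(z)`. -/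
def System.d (𝔽 : System s r) (deg : Fin e → (Fin n →₀ ℕ)) (p : ℕ) :
    𝔽.Term n (p + 1) →ₗ[Poly K n] 𝔽.Term n p :=
  LinearMap.pi fun J => ∑ I : Face e (r + 1 + (p + 1)),
    (MvPolynomial.monomial (faceDeg deg I.1 - faceDeg deg J.1) (1 : K) : Poly K n) •
      ((𝔽.comp p I J).baseChange (Poly K n) ∘ₗ LinearMap.proj I)

/-- The differential `φ_2 : R_2 → R_1 = E` of the BRT complex, with components
`y ⊗ z ↦ x^(|e_J| - |e_l|) y s_2^{J,l}(z) • e_l`. -/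
def System.dTwo (𝔽 : System s r) {E : Type w} [AddCommGroup E] [Module (Poly K n) E]
    (bE : FreeMultigraded K n e E) : 𝔽.Term n 0 →ₗ[Poly K n] E :=
  ∑ J : Face e (r + 1), ∑ t : Fin (r + 1),
    (MvPolynomial.monomial
        (faceDeg bE.deg J.1 - bE.deg (J.1.orderEmbOfFin J.2 t)) (1 : K) : Poly K n) •
      (LinearMap.toSpanSingleton (Poly K n) E (bE.basis (J.1.orderEmbOfFin J.2 t)) ∘ₗ
        (TensorProduct.AlgebraTensorModule.rid K (Poly K n) (Poly K n)).toLinearMap ∘ₗ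
        (spliceComp s J t ∘ₗ (𝔽.F 0 J).subtype.rTensor _).baseChange (Poly K n) ∘ₗ
        LinearMap.proj J)

variable {E : Type*} [AddCommGroup E] [Module (Poly K n) E] {G : Type*} [AddCommGroup G]
  [Module (Poly K n) G]

/-- Consecutive maps in `⋯ → R_3 → R_2 → R_1 = E → R_0 = G` compose to zero. -/
def System.IsComplex (𝔽 : System s r) (bE : FreeMultigraded K n e E)
    (φ : E →ₗ[Poly K n] G) : Prop :=
  φ ∘ₗ 𝔽.dTwo bE = 0 ∧ 𝔽.dTwo bE ∘ₗ 𝔽.d bE.deg 0 = 0 ∧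
    ∀ p, 𝔽.d bE.deg p ∘ₗ 𝔽.d bE.deg (p + 1) = 0

/-- The homology of `⋯ → R_3 → R_2 → R_1 = E → R_0 = G` vanishes in all positive degrees. -/
def System.IsExact (𝔽 : System s r) (bE : FreeMultigraded K n e E)
    (φ : E →ₗ[Poly K n] G) : Prop :=
  Function.Exact (𝔽.dTwo bE) φ ∧ Function.Exact (𝔽.d bE.deg 0) (𝔽.dTwo bE) ∧
    ∀ p, Function.Exact (𝔽.d bE.deg (p + 1)) (𝔽.d bE.deg p)

end Complex

/-! ### The Taylor complex -/

/-- The map `s : U → V` of `K`-vector spaces given by the coefficient matrix of `φ`, with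
`U = K^e` and `V ⊆ W = K^g` its image. -/
def coeffMap {K : Type u} [Field K] {n e g : ℕ} {E : Type v} [AddCommGroup E]
    [Module (Poly K n) E] {G : Type w} [AddCommGroup G] [Module (Poly K n) G]
    (bE : FreeMultigraded K n e E) (bG : FreeMultigraded K n g G) (φ : E →ₗ[Poly K n] G) :
    (Fin e → K) →ₗ[K] LinearMap.range (coeffMatrix bE bG φ).mulVecLin :=
  (coeffMatrix bE bG φ).mulVecLin.rangeRestrict

/-- The full BRT system of `φ`; the Taylor complex of `φ` is the BRT complex of this system. -/
def taylor {K : Type u} [Field K] {n e g : ℕ} {E : Type v} [AddCommGroup E]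
    [Module (Poly K n) E] {G : Type w} [AddCommGroup G] [Module (Poly K n) G]
    (bE : FreeMultigraded K n e E) (bG : FreeMultigraded K n g G) (φ : E →ₗ[Poly K n] G) :
    System (coeffMap bE bG φ) (mapRank φ) :=
  fullSystem (coeffMap bE bG φ) (mapRank φ)

end BRT

end

/-! All maps preserve multidegrees, so the complex splits over K into strands, one for each degree
a. The summand on e_I contributes to degree a exactly when |e_I| ≤ a, that is, when I ⊆ A = {j :
|e_j| ≤ a}, and the monomials in the differentials then disappear (`strand_d`, `basisStrand_dTwo`).
After a choice of generator of the line ⋀^r V*, the strand is the Buchsbaum–Rim complex of s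
restricted to K^A, with V unchanged; here dim V = r by `IsMultigraded.mapRank_eq`.

Suppose C_a has maximal rank. If #A < r, the columns in A are independent and no face inside A has r
+ 1 elements, so the strand is trivially exact. Otherwise some B ⊆ A indexes a basis of V. For b ∈
B, exterior multiplication by e_b combined with the transpose of division by the variable b in Sym V
is a homotopy that moves a cycle into the multiples of e_b (`koszul_homotopy`). Division, unlike
differentiation, works in every characteristic. Treating all b ∈ B in turn
(`koszul_exists_reduction`) makes a cycle with coefficients in D_p V*, p ≥ 1, a boundary. In D_0 V*
it leaves only faces B ∪ {c}, whose coefficients can be read off from the splice map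
(`splice_exact`). Cramer's rule links the splice map to its neighbours.

Conversely, exactness at E suffices: a nontrivial relation among the columns in A is then an image
under the splice map, which requires r independent columns in A (`finrank_span_eq_min`). -/

open scoped TensorProduct

noncomputable section

namespace BRT

universe u v w

/-! ### Koszul differentials on functions on the full simplex -/

section Koszul

variable {K : Type*} [Field K] {e : ℕ} {L M N : Type*} [AddCommGroup L] [Module K L]
  [AddCommGroup M] [Module K M] [AddCommGroup N] [Module K N]

lemma sgn_mul_self (J : Finset (Fin e)) (l : Fin e) : sgn (K := K) J l * sgn J l = 1 := by
  rw [sgn, ← pow_add, ← two_mul, pow_mul]; simp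

lemma sgn_ne_zero (J : Finset (Fin e)) (l : Fin e) : sgn (K := K) J l ≠ 0 := by
  simp [sgn]

lemma sgn_insert_self (J : Finset (Fin e)) (l : Fin e) :
    sgn (K := K) (insert l J) l = sgn J l := by
  simp [sgn, Finset.filter_insert]

lemma sgn_erase_self (J : Finset (Fin e)) (l : Fin e) :
    sgn (K := K) (J.erase l) l = sgn J l := by
  rw [sgn, sgn, Finset.filter_erase, Finset.erase_eq_of_notMem (by simp)]

lemma sgn_insert_of_lt {J : Finset (Fin e)} {j l : Fin e} (hj : j ∉ J) (h : j < l) :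
    sgn (K := K) (insert j J) l = -sgn J l := by
  rw [sgn, sgn, Finset.filter_insert, if_pos h, Finset.card_insert_of_notMem (by simp [hj]),
    pow_succ]
  ring

lemma sgn_insert_of_gt {J : Finset (Fin e)} {j l : Fin e} (h : l < j) :
    sgn (K := K) (insert j J) l = sgn J l := by
  rw [sgn, sgn, Finset.filter_insert, if_neg h.not_gt]

/-- Of the two orders of insertion exactly one meets the other new element, the smaller of j and l
going in first. This is the sign behind e_j ∧ e_l = -e_l ∧ e_j. -/
lemma sgn_mul_sgn_insert {J : Finset (Fin e)} {j l : Fin e} (hj : j ∉ J) (hl : l ∉ J)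
    (h : j ≠ l) :
    sgn (K := K) J j * sgn (insert j J) l = -(sgn J l * sgn (insert l J) j) := by
  rcases lt_or_gt_of_ne h with h | h
  · rw [sgn_insert_of_lt hj h, sgn_insert_of_gt h]; ring
  · rw [sgn_insert_of_lt hl h, sgn_insert_of_gt h]; ring

/-- Contraction with the `l`-th coordinate functional. -/
def interior (l : Fin e) : (Finset (Fin e) → M) →ₗ[K] (Finset (Fin e) → M) where
  toFun z J := if l ∈ J then 0 else sgn (K := K) J l • z (insert l J)
  map_add' x y := by ext J; by_cases h : l ∈ J <;> simp [h]
  map_smul' c x := by ext J; by_cases h : l ∈ J <;> simp [h, smul_comm c]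

/-- Left multiplication by the `l`-th basis vector. -/
def exterior (l : Fin e) : (Finset (Fin e) → M) →ₗ[K] (Finset (Fin e) → M) where
  toFun z J := if l ∈ J then sgn (K := K) J l • z (J.erase l) else 0
  map_add' x y := by ext J; by_cases h : l ∈ J <;> simp [h]
  map_smul' c x := by ext J; by_cases h : l ∈ J <;> simp [h, smul_comm c]

lemma interior_apply (l : Fin e) (z : Finset (Fin e) → M) (J : Finset (Fin e)) :
    interior (K := K) l z J = if l ∈ J then 0 else sgn (K := K) J l • z (insert l J) := rfl

lemma exterior_apply (l : Fin e) (z : Finset (Fin e) → M) (J : Finset (Fin e)) :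
    exterior (K := K) l z J = if l ∈ J then sgn (K := K) J l • z (J.erase l) else 0 := rfl

lemma interior_compLeft (l : Fin e) (c : M →ₗ[K] N) (z : Finset (Fin e) → M) :
    interior (K := K) l (c.compLeft _ z) = c.compLeft _ (interior (K := K) l z) := by
  ext J; by_cases h : l ∈ J <;> simp [interior_apply, h]

lemma exterior_compLeft (l : Fin e) (c : M →ₗ[K] N) (z : Finset (Fin e) → M) :
    exterior (K := K) l (c.compLeft _ z) = c.compLeft _ (exterior (K := K) l z) := by
  ext J; by_cases h : l ∈ J <;> simp [exterior_apply, h]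

lemma interior_interior (j l : Fin e) (z : Finset (Fin e) → M) :
    interior (K := K) j (interior (K := K) l z) =
      -interior (K := K) l (interior (K := K) j z) := by
  ext J
  simp only [interior_apply, Pi.neg_apply]
  rcases eq_or_ne j l with rfl | h
  · simp
  by_cases hj : j ∈ J <;> by_cases hl : l ∈ J <;> simp [hj, hl, h, h.symm]
  rw [smul_smul, smul_smul, ← neg_smul, sgn_mul_sgn_insert hj hl h, Finset.insert_comm]

/-- The Clifford relation: contraction is an antiderivation for the wedge product. -/
lemma interior_exterior (j l : Fin e) (z : Finset (Fin e) → M) :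
    interior (K := K) j (exterior (K := K) l z) =
      (if j = l then z else 0) - exterior (K := K) l (interior (K := K) j z) := by
  ext J
  simp only [interior_apply, exterior_apply, Pi.sub_apply]
  rcases eq_or_ne j l with rfl | h
  · by_cases hj : j ∈ J
    · simp [hj, smul_smul, sgn_erase_self, sgn_mul_self]
    · simp [hj, smul_smul, sgn_insert_self, sgn_mul_self]
  by_cases hj : j ∈ J <;> by_cases hl : l ∈ J <;> simp [hj, hl, h, h.symm]
  obtain ⟨J, hl', rfl⟩ : ∃ J', l ∉ J' ∧ insert l J' = J :=
    ⟨J.erase l, by simp, Finset.insert_erase hl⟩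
  have hj' : j ∉ J := fun h => hj (Finset.mem_insert_of_mem h)
  rw [smul_smul, smul_smul, ← neg_smul, Finset.insert_comm, Finset.erase_insert (by simp [hl', h.symm]),
    Finset.erase_insert hl', sgn_insert_self, sgn_insert_self]
  congr 1
  have key := sgn_mul_sgn_insert (K := K) hl' hj' h.symm
  have h1 := sgn_mul_self (K := K) (insert j J) l
  have h2 := sgn_mul_self (K := K) J l
  linear_combination (sgn (K := K) J l * sgn (insert j J) l) * key -
    sgn (K := K) (insert l J) j * sgn (insert j J) l * h2 - sgn (K := K) J l * sgn J j * h1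

/-- The Koszul differential attached to a family of maps `c l : M → N`. -/
def koszul (c : Fin e → M →ₗ[K] N) : (Finset (Fin e) → M) →ₗ[K] (Finset (Fin e) → N) :=
  ∑ l, interior l ∘ₗ (c l).compLeft _

lemma koszul_eq_sum (c : Fin e → M →ₗ[K] N) (z : Finset (Fin e) → M) :
    koszul c z = ∑ l, interior (K := K) l ((c l).compLeft _ z) := by
  simp [koszul]

/-- The coefficient maps are symmetric in (j, l) and the contractions antisymmetric, so swapping the
indices cancels the terms in pairs; diagonal terms vanish. -/
lemma koszul_koszul (c : Fin e → M →ₗ[K] N) (c' : Fin e → N →ₗ[K] L)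
    (hc : ∀ j l, c' j ∘ₗ c l = c' l ∘ₗ c j) (z : Finset (Fin e) → M) :
    koszul c' (koszul c z) = 0 := by
  have h : ∀ j l, (c' j).compLeft (Finset (Fin e)) ((c l).compLeft _ z) =
      (c' l).compLeft _ ((c j).compLeft _ z) := fun j l => by
    ext J; exact LinearMap.congr_fun (hc j l) (z J)
  simp only [koszul_eq_sum, map_sum, interior_compLeft]
  rw [← Finset.sum_product']
  refine Finset.sum_involution (fun p _ => p.swap) ?_ ?_ (by simp) (by simp)
  · rintro ⟨j, l⟩ -
    simp only [Prod.swap, ← interior_compLeft]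
    rw [interior_interior, h, neg_add_cancel]
  · rintro ⟨j, l⟩ - hne heq
    simp only [Prod.swap, Prod.mk.injEq] at heq
    obtain rfl := heq.1
    refine hne ?_
    ext J
    simp [interior_apply]

/-- The operator `z ↦ ∑ l, a l • (e_b ∧ (e_l ⌟ z))`. -/
def replace (a : Fin e → K) (b : Fin e) : (Finset (Fin e) → M) →ₗ[K] (Finset (Fin e) → M) :=
  ∑ l, a l • (exterior b ∘ₗ interior l)

lemma replace_eq_sum (a : Fin e → K) (b : Fin e) (z : Finset (Fin e) → M) :
    replace a b z = ∑ l, a l • exterior (K := K) b (interior (K := K) l z) := by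
  simp [replace]

/-- Multiplication by `e_b` combined with a partial inverse `m` of `c b` is a homotopy between the
identity and an operator with image in the multiples of `e_b`. -/
lemma koszul_homotopy (c : Fin e → M →ₗ[K] N) (c' : Fin e → N →ₗ[K] L) (m : N →ₗ[K] M)
    (m' : L →ₗ[K] N) (a : Fin e → K) (b : Fin e) (hb : a b = 1)
    (h : ∀ l x, c l (m x) = m' (c' l x) + a l • (x - m' (c' b x))) (z : Finset (Fin e) → N)
    (hz : koszul c' z = 0) :
    z = koszul c (exterior (K := K) b (m.compLeft _ z)) +
      replace a b (z - m'.compLeft _ ((c' b).compLeft _ z)) := by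
  have h' : ∀ l, (c l).compLeft (Finset (Fin e)) (m.compLeft _ z) =
      m'.compLeft _ ((c' l).compLeft _ z) +
        a l • (z - m'.compLeft _ ((c' b).compLeft _ z)) := fun l => by
    ext J; exact h l (z J)
  set y := z - m'.compLeft _ ((c' b).compLeft _ z) with hy
  -- Up to moving `m'` and the wedge with e_b outside the sum, this is `koszul c' z`.
  have h2 : ∑ l, exterior (K := K) b (interior (K := K) l
      (m'.compLeft _ ((c' l).compLeft _ z))) = 0 := by
    have : ∑ l, interior (K := K) l (m'.compLeft _ ((c' l).compLeft _ z)) = 0 := by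
      simp only [interior_compLeft _ m']
      rw [← map_sum]
      simp only [interior_compLeft]
      rw [koszul_eq_sum] at hz
      simp only [interior_compLeft] at hz
      rw [hz, map_zero]
    rw [← map_sum, this, map_zero]
  have h3 : ∀ l, interior (K := K) l ((c l).compLeft _ (exterior (K := K) b (m.compLeft _ z))) =
      (if l = b then z else 0) - exterior (K := K) b (interior (K := K) l
      (m'.compLeft _ ((c' l).compLeft _ z))) -
        a l • exterior (K := K) b (interior (K := K) l y) := fun l => by
    rw [← exterior_compLeft, h', interior_exterior, map_add, map_add, map_smul, map_smul]
    rcases eq_or_ne l b with rfl | hl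
    · simp [hb, hy]
    · simp [hl]; abel
  rw [koszul_eq_sum, Finset.sum_congr rfl fun l _ => h3 l, Finset.sum_sub_distrib,
    Finset.sum_sub_distrib, h2, replace_eq_sum]
  simp

end Koszul

/-! ### Chains on the faces of a vertex set, and reduction of cycles -/

section Supported

variable (K : Type*) [Field K] {e : ℕ} {L M N : Type*} [AddCommGroup L] [Module K L]
  [AddCommGroup M] [Module K M] [AddCommGroup N] [Module K N]

variable (M) in
/-- The functions on faces which vanish outside the `q`-element subsets of `A`. -/
def supported (A : Finset (Fin e)) (q : ℕ) : Submodule K (Finset (Fin e) → M) where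
  carrier := {z | ∀ I, ¬(I ⊆ A ∧ I.card = q) → z I = 0}
  add_mem' hx hy I hI := by simp [hx I hI, hy I hI]
  zero_mem' _ _ := rfl
  smul_mem' c x hx I hI := by simp [hx I hI]

variable {K} {A : Finset (Fin e)} {q : ℕ}

lemma compLeft_mem_supported (c : M →ₗ[K] N) {z : Finset (Fin e) → M}
    (hz : z ∈ supported K M A q) : c.compLeft _ z ∈ supported K N A q := fun I hI => by
  simp [hz I hI]

lemma interior_mem_supported (l : Fin e) {z : Finset (Fin e) → M}
    (hz : z ∈ supported K M A (q + 1)) : interior (K := K) l z ∈ supported K M A q := by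
  intro I hI
  rw [interior_apply]
  split_ifs with h
  · rfl
  · rw [hz, smul_zero]
    rintro ⟨h1, h2⟩
    rw [Finset.card_insert_of_notMem h] at h2
    exact hI ⟨(Finset.subset_insert _ _).trans h1, by omega⟩

lemma exterior_mem_supported {b : Fin e} (hb : b ∈ A) {z : Finset (Fin e) → M}
    (hz : z ∈ supported K M A q) : exterior (K := K) b z ∈ supported K M A (q + 1) := by
  intro I hI
  rw [exterior_apply]
  split_ifs with h
  · rw [hz, smul_zero]
    rintro ⟨h1, h2⟩
    have := Finset.card_erase_add_one h
    refine hI ⟨?_, by omega⟩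
    rw [← Finset.insert_erase h]
    exact Finset.insert_subset hb h1
  · rfl

lemma koszul_mem_supported (c : Fin e → M →ₗ[K] N) {z : Finset (Fin e) → M}
    (hz : z ∈ supported K M A (q + 1)) : koszul c z ∈ supported K N A q := by
  rw [koszul_eq_sum]
  exact Submodule.sum_mem _ fun l _ => interior_mem_supported l (compLeft_mem_supported _ hz)

lemma replace_mem_supported (a : Fin e → K) {b : Fin e} (hb : b ∈ A) {z : Finset (Fin e) → M}
    (hz : z ∈ supported K M A q) : replace a b z ∈ supported K M A q := by
  rw [replace_eq_sum]
  refine Submodule.sum_mem _ fun l _ => Submodule.smul_mem _ _ ?_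
  cases q with
  | succ q => exact exterior_mem_supported hb (interior_mem_supported l hz)
  | zero =>
    have : interior (K := K) l z = 0 := by
      ext J
      rw [interior_apply]
      split_ifs with h
      · rfl
      · rw [hz _ (by simp), smul_zero, Pi.zero_apply]
    rw [this, map_zero]
    exact Submodule.zero_mem _

lemma replace_apply_eq_zero (a : Fin e → K) (b : Fin e) (z : Finset (Fin e) → M)
    {I : Finset (Fin e)} (h : ∀ l, a l ≠ 0 → z (insert l (I.erase b)) = 0) :
    replace a b z I = 0 := by
  rw [replace_eq_sum, Finset.sum_apply]
  refine Finset.sum_eq_zero fun l _ => ?_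
  rw [Pi.smul_apply, exterior_apply, interior_apply]
  by_cases hl : a l = 0
  · simp [hl]
  · simp [h l hl]

lemma replace_apply_of_notMem (a : Fin e → K) (b : Fin e) (z : Finset (Fin e) → M)
    {I : Finset (Fin e)} (h : b ∉ I) : replace a b z I = 0 := by
  rw [replace_eq_sum, Finset.sum_apply]
  refine Finset.sum_eq_zero fun l _ => ?_
  rw [Pi.smul_apply, exterior_apply, if_neg h, smul_zero]

/-- The homotopies for the indices in S are applied one after another. Each changes z by a boundary
and leaves a remainder that lives on faces containing `β k` and is killed by `c' (β k)`. Later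
passes do not destroy this: `ha` prevents them from inserting an earlier `β k'`, and `hP` keeps the
coefficients in the earlier kernels. -/
lemma koszul_exists_reduction {κ : Type*} [DecidableEq κ] (c : Fin e → M →ₗ[K] N)
    (c' : Fin e → N →ₗ[K] L) (m : κ → N →ₗ[K] M) (m' : κ → L →ₗ[K] N) (a : κ → Fin e → K)
    (β : κ → Fin e) (ha : ∀ k k', a k (β k') = if k = k' then 1 else 0)
    (h : ∀ k l x, c l (m k x) = m' k (c' l x) + a k l • (x - m' k (c' (β k) x)))
    (hP : ∀ k k' x, (k' = k ∨ c' (β k') x = 0) → c' (β k') (x - m' k (c' (β k) x)) = 0)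
    (hcc : ∀ j l, c' j ∘ₗ c l = c' l ∘ₗ c j) (hβ : ∀ k, β k ∈ A)
    {z : Finset (Fin e) → N} (hz : koszul c' z = 0) (hA : z ∈ supported K N A q)
    (S : Finset κ) :
    ∃ w ∈ supported K M A (q + 1), ∃ z' ∈ supported K N A q, z = koszul c w + z' ∧
      koszul c' z' = 0 ∧ ∀ k ∈ S, ∀ I, (β k ∉ I → z' I = 0) ∧ c' (β k) (z' I) = 0 := by
  induction S using Finset.induction_on with
  | empty => exact ⟨0, Submodule.zero_mem _, z, hA, by simp, hz, by simp⟩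
  | insert k S hk ih =>
    obtain ⟨w, hw, z', hz', rfl, hc, hS⟩ := ih
    have key := koszul_homotopy c c' (m k) (m' k) (a k) (β k) (by simp [ha]) (h k) z' hc
    set P := z' - (m' k).compLeft _ ((c' (β k)).compLeft _ z') with hPdef
    have hPa : ∀ I, P I = z' I - m' k (c' (β k) (z' I)) := fun I => by simp [hPdef]
    have hu : exterior (K := K) (β k) ((m k).compLeft _ z') ∈ supported K M A (q + 1) :=
      exterior_mem_supported (hβ k) (compLeft_mem_supported _ hz')
    have hPs : P ∈ supported K N A q := Submodule.sub_mem _ hz'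
      (compLeft_mem_supported _ (compLeft_mem_supported _ hz'))
    have hc2 : ∀ k' ∈ insert k S, ∀ I, c' (β k') (replace (a k) (β k) P I) = 0 := by
      intro k' hk' I
      have h1 : ∀ J, c' (β k') (P J) = 0 := fun J => by
        rw [hPa]
        refine hP k k' _ ?_
        rcases Finset.mem_insert.1 hk' with h | h
        · exact Or.inl h
        · exact Or.inr (hS k' h J).2
      have h2 : (c' (β k')).compLeft (Finset (Fin e)) P = 0 := by
        ext J; exact h1 J
      have h3 : (c' (β k')).compLeft (Finset (Fin e)) (replace (a k) (β k) P) = 0 := by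
        rw [replace_eq_sum, map_sum]
        refine Finset.sum_eq_zero fun l _ => ?_
        rw [map_smul, ← exterior_compLeft, ← interior_compLeft, h2, map_zero, map_zero, smul_zero]
      exact congrFun h3 I
    refine ⟨w + exterior (K := K) (β k) ((m k).compLeft _ z'), Submodule.add_mem _ hw hu,
      replace (a k) (β k) P, replace_mem_supported _ (hβ k) hPs, ?_, ?_, ?_⟩
    · rw [map_add, add_assoc, ← key]
    · have := congrArg (koszul c') key
      rwa [hc, map_add, koszul_koszul c c' hcc, zero_add, eq_comm] at this
    · refine fun k' hk' I => ⟨fun hI => ?_, hc2 k' hk' I⟩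
      rcases Finset.mem_insert.1 hk' with rfl | hk''
      · exact replace_apply_of_notMem _ _ _ hI
      · refine replace_apply_eq_zero _ _ _ fun l hl => ?_
        have hne : k ≠ k' := fun h => hk (h ▸ hk'')
        -- The inserted l differs from `β k'`, because `a k l ≠ 0` while `a k (β k') = 0`.
        have hz0 : z' (insert l (I.erase (β k))) = 0 := by
          refine (hS k' hk'' _).1 fun hmem => ?_
          rcases Finset.mem_insert.1 hmem with h | h
          · rw [← h, ha, if_neg hne] at hl
            exact hl rfl
          · exact hI (Finset.mem_of_mem_erase h)
        rw [hPa, hz0, map_zero, map_zero, sub_zero]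

end Supported

/-! ### Divided powers: contraction and its partial inverses -/

section DividedPowers

variable {K : Type u} [Field K] {V : Type v} [AddCommGroup V] [Module K V] {κ : Type*} {e : ℕ}

/-- Division by the variable `b k` in the symmetric algebra, with respect to the basis `b`. -/
def symDiv (b : Module.Basis κ K V) (k : κ) : SymmetricAlgebra K V →ₗ[K] SymmetricAlgebra K V where
  toFun x := (SymmetricAlgebra.equivMvPolynomial b).symm
    ((SymmetricAlgebra.equivMvPolynomial b x).divMonomial (Finsupp.single k 1))
  map_add' x y := by simp [MvPolynomial.add_divMonomial]
  map_smul' t x := by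
    rw [RingHom.id_apply, ← map_smul, map_smul]
    congr 1
    ext ν
    simp [MvPolynomial.coeff_divMonomial]

lemma symDiv_apply (b : Module.Basis κ K V) (k : κ) (x : SymmetricAlgebra K V) :
    symDiv b k x = (SymmetricAlgebra.equivMvPolynomial b).symm
    ((SymmetricAlgebra.equivMvPolynomial b x).divMonomial (Finsupp.single k 1)) := rfl

lemma symDiv_one (b : Module.Basis κ K V) (k : κ) : symDiv b k 1 = 0 := by
  classical
  rw [symDiv_apply, map_one, EmbeddingLike.map_eq_zero_iff]
  ext ν
  rw [MvPolynomial.coeff_divMonomial, MvPolynomial.coeff_one, if_neg, MvPolynomial.coeff_zero]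
  intro h
  have := DFunLike.congr_fun h k
  simp at this
  omega

/-- Both sides are linear in v, so basis vectors suffice. Multiplication by another variable
commutes with division by b_k. Multiplication by b_k is undone by it, and the correction is the
remainder of x, its part free of b_k. -/
lemma symDiv_ι_mul (b : Module.Basis κ K V) (k : κ) (v : V) (x : SymmetricAlgebra K V) :
    symDiv b k (SymmetricAlgebra.ι K V v * x) = SymmetricAlgebra.ι K V v * symDiv b k x +
      b.coord k v • (x - SymmetricAlgebra.ι K V (b k) * symDiv b k x) := by
  classical
  let f : V →ₗ[K] SymmetricAlgebra K V :=
    symDiv b k ∘ₗ LinearMap.mulRight K x ∘ₗ SymmetricAlgebra.ι K V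
  let g : V →ₗ[K] SymmetricAlgebra K V :=
    LinearMap.mulRight K (symDiv b k x) ∘ₗ SymmetricAlgebra.ι K V +
      LinearMap.toSpanSingleton K _ (x - SymmetricAlgebra.ι K V (b k) * symDiv b k x) ∘ₗ b.coord k
  suffices f = g from LinearMap.congr_fun this v
  refine b.ext fun i => ?_
  change symDiv b k (SymmetricAlgebra.ι K V (b i) * x) = SymmetricAlgebra.ι K V (b i) *
    symDiv b k x + b.coord k (b i) • (x - SymmetricAlgebra.ι K V (b k) * symDiv b k x)
  apply (SymmetricAlgebra.equivMvPolynomial b).injective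
  set X := SymmetricAlgebra.equivMvPolynomial b x with hX
  rcases eq_or_ne i k with rfl | h
  · simp [symDiv_apply, ← hX]
  · have : b.coord k (b i) = 0 := by simp [Finsupp.single_eq_of_ne h.symm]
    rw [this, zero_smul, add_zero]
    simp only [symDiv_apply, map_mul, SymmetricAlgebra.equivMvPolynomial_ι_apply, ← hX,
      AlgEquiv.apply_symm_apply]
    ext ν
    rw [MvPolynomial.coeff_divMonomial, MvPolynomial.coeff_X_mul', MvPolynomial.coeff_X_mul',
      MvPolynomial.coeff_divMonomial]
    simp only [Finsupp.mem_support_iff, Finsupp.add_apply, Finsupp.single_eq_of_ne h, zero_add]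
    split_ifs with h0
    · congr 1
      rw [add_tsub_assoc_of_le]
      exact Finsupp.single_le_iff.2 (Nat.one_le_iff_ne_zero.2 h0)
    · rfl

lemma ι_mul_mem_symPow {p : ℕ} (v : V) {x : SymmetricAlgebra K V} (hx : x ∈ SymPow K V p) :
    SymmetricAlgebra.ι K V v * x ∈ SymPow K V (p + 1) :=
  (symMul p v ⟨x, hx⟩).2

lemma symPow_succ_induction {p : ℕ} {P : SymmetricAlgebra K V → Prop}
    (mul : ∀ v, ∀ x ∈ SymPow K V p, P (SymmetricAlgebra.ι K V v * x))
    (add : ∀ x y, P x → P y → P (x + y)) {x : SymmetricAlgebra K V}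
    (hx : x ∈ SymPow K V (p + 1)) : P x := by
  rw [SymPow, pow_succ'] at hx
  refine Submodule.mul_induction_on hx ?_ add
  rintro _ ⟨v, rfl⟩ y hy
  exact mul v y hy

lemma symDiv_mem (b : Module.Basis κ K V) (k : κ) {p : ℕ} {x : SymmetricAlgebra K V}
    (hx : x ∈ SymPow K V (p + 1)) : symDiv b k x ∈ SymPow K V p := by
  induction p generalizing x with
  | zero =>
    refine symPow_succ_induction (P := fun x => symDiv b k x ∈ SymPow K V 0) ?_ ?_ hx
    · intro v x hx
      obtain ⟨t, rfl⟩ : ∃ t : K, algebraMap K _ t = x := by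
        rw [SymPow, pow_zero] at hx
        exact Submodule.mem_one.1 hx
      rw [symDiv_ι_mul, Algebra.algebraMap_eq_smul_one, map_smul, symDiv_one, smul_zero, mul_zero,
        mul_zero, zero_add, sub_zero, ← Algebra.algebraMap_eq_smul_one]
      exact Submodule.smul_mem _ _ hx
    · intro x y hx hy
      rw [map_add]
      exact Submodule.add_mem _ hx hy
  | succ p ih =>
    refine symPow_succ_induction (P := fun x => symDiv b k x ∈ SymPow K V (p + 1)) ?_ ?_ hx
    · intro v x hx
      rw [symDiv_ι_mul]
      exact Submodule.add_mem _ (ι_mul_mem_symPow v (ih hx)) (Submodule.smul_mem _ _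
        (Submodule.sub_mem _ hx (ι_mul_mem_symPow _ (ih hx))))
    · intro x y hx hy
      rw [map_add]
      exact Submodule.add_mem _ hx hy

/-- The transpose of division by the variable `b k`, a right inverse of contraction with `b k`. -/
def divMul (b : Module.Basis κ K V) (k : κ) (p : ℕ) : DivPow K V p →ₗ[K] DivPow K V (p + 1) :=
  Module.Dual.transpose ((symDiv b k).restrict fun _ hx => symDiv_mem b k hx)

lemma divMul_apply (b : Module.Basis κ K V) (k : κ) (p : ℕ) (f : DivPow K V p)
    (x : SymPow K V (p + 1)) :
    divMul b k p f x = f ⟨symDiv b k x, symDiv_mem b k x.2⟩ := rfl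

lemma contract_apply (p : ℕ) (v : V) (f : DivPow K V (p + 1)) (x : SymPow K V p) :
    contract p v f x = f ⟨SymmetricAlgebra.ι K V v * x, ι_mul_mem_symPow v x.2⟩ := rfl

lemma contract_comm (p : ℕ) (v w : V) :
    (contract p v ∘ₗ contract (p + 1) w : DivPow K V (p + 2) →ₗ[K] DivPow K V p) =
      contract p w ∘ₗ contract (p + 1) v := by
  ext f x
  simp only [LinearMap.comp_apply, contract_apply]
  congr 2
  ring

/-- The transpose of `symDiv_ι_mul`; it is the hypothesis of `koszul_homotopy`, with the coordinates
of v as the coefficients a. -/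
lemma contract_divMul_succ (b : Module.Basis κ K V) (k : κ) (p : ℕ) (v : V)
    (f : DivPow K V (p + 1)) :
    contract (p + 1) v (divMul b k (p + 1) f) = divMul b k p (contract p v f) +
      b.coord k v • (f - divMul b k p (contract p (b k) f)) := by
  ext x
  simp only [contract_apply, divMul_apply, LinearMap.add_apply, LinearMap.sub_apply,
    LinearMap.smul_apply]
  rw [← map_sub, ← map_smul, ← map_add]
  congr 1
  exact Subtype.ext (symDiv_ι_mul b k v x)

/-- At the bottom the correction terms vanish, since division by a variable kills constants. -/
lemma contract_divMul_zero (b : Module.Basis κ K V) (k : κ) (v : V) (f : DivPow K V 0) :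
    contract 0 v (divMul b k 0 f) = b.coord k v • f := by
  ext ⟨x, hx⟩
  simp only [contract_apply, divMul_apply, LinearMap.smul_apply]
  rw [← map_smul]
  congr 1
  refine Subtype.ext ?_
  obtain ⟨t, rfl⟩ : ∃ t : K, algebraMap K _ t = x := by
    rw [SymPow, pow_zero] at hx
    exact Submodule.mem_one.1 hx
  change symDiv b k (SymmetricAlgebra.ι K V v * algebraMap K _ t) = b.coord k v • algebraMap K _ t
  rw [symDiv_ι_mul, Algebra.algebraMap_eq_smul_one, map_smul, symDiv_one, smul_zero, mul_zero,
    mul_zero, zero_add, sub_zero]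

lemma contract_divMul_self (b : Module.Basis κ K V) (k : κ) (p : ℕ) (f : DivPow K V p) :
    contract p (b k) (divMul b k p f) = f := by
  cases p with
  | zero => simp [contract_divMul_zero]
  | succ p => rw [contract_divMul_succ]; simp

lemma contract_divMul_eq_zero {b : Module.Basis κ K V} {k k' : κ} (h : k' ≠ k) {p : ℕ}
    {f : DivPow K V (p + 1)} (hf : contract p (b k') f = 0) :
    contract p (b k') (divMul b k p (contract p (b k) f)) = 0 := by
  have hc : b.coord k (b k') = 0 := by simp [Finsupp.single_eq_of_ne h.symm]
  cases p with
  | zero => rw [contract_divMul_zero, hc, zero_smul]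
  | succ p =>
    rw [contract_divMul_succ, hc, zero_smul, add_zero,
      ← LinearMap.comp_apply (contract p (b k')), contract_comm, LinearMap.comp_apply, hf,
      map_zero, map_zero]

/-- Products of a vector with S_p V span S_{p+1} V. There is no analogue for D_0 V*, which is why
the splice map needs a separate argument. -/
lemma eq_zero_of_contract_eq_zero (b : Module.Basis κ K V) {p : ℕ} {f : DivPow K V (p + 1)}
    (h : ∀ k, contract p (b k) f = 0) : f = 0 := by
  have h' : ∀ (v : V) (x : SymPow K V p), contract p v f x = 0 := by
    intro v x
    let g : V →ₗ[K] K := f ∘ₗ (LinearMap.mulRight K (x : SymmetricAlgebra K V) ∘ₗ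
      SymmetricAlgebra.ι K V).codRestrict (SymPow K V (p + 1)) fun v => ι_mul_mem_symPow v x.2
    suffices g = 0 from LinearMap.congr_fun this v
    exact b.ext fun k => LinearMap.congr_fun (h k) x
  ext ⟨x, hx⟩
  suffices ∀ hx : x ∈ SymPow K V (p + 1), f ⟨x, hx⟩ = 0 from this hx
  suffices ∃ hx : x ∈ SymPow K V (p + 1), f ⟨x, hx⟩ = 0 from fun _ => this.2
  refine symPow_succ_induction (P := fun x => ∃ hx : x ∈ SymPow K V (p + 1), f ⟨x, hx⟩ = 0) ?_ ?_ hx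
  · exact fun v x hx => ⟨ι_mul_mem_symPow v hx, h' v ⟨x, hx⟩⟩
  · rintro x y ⟨hx, hx'⟩ ⟨hy, hy'⟩
    refine ⟨Submodule.add_mem _ hx hy, ?_⟩
    have := map_add f ⟨x, hx⟩ ⟨y, hy⟩
    rw [hx', hy', add_zero] at this
    exact this

/-- The Koszul differential on `D V* ⊗ ⋀ U` attached to the vectors `y l`. -/
def divKoszul (y : Fin e → V) (p : ℕ) :
    (Finset (Fin e) → DivPow K V (p + 1)) →ₗ[K] (Finset (Fin e) → DivPow K V p) :=
  koszul fun l => contract p (y l)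

lemma divKoszul_divKoszul (y : Fin e → V) (p : ℕ) (z : Finset (Fin e) → DivPow K V (p + 2)) :
    divKoszul y p (divKoszul y (p + 1) z) = 0 :=
  koszul_koszul _ _ (fun _ _ => contract_comm _ _ _) z

variable [Finite κ] {A : Finset (Fin e)} {q : ℕ} {y : Fin e → V}

/-- After the reduction along the whole basis, the remainder is killed by contraction with every
basis vector, hence zero. -/
lemma divKoszul_exact (b : Module.Basis κ K V) (β : κ → Fin e) (hb : ∀ k, y (β k) = b k)
    (hβ : ∀ k, β k ∈ A) {p : ℕ} {z : Finset (Fin e) → DivPow K V (p + 1)}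
    (hz : divKoszul y p z = 0) (hA : z ∈ supported K _ A q) :
    ∃ w ∈ supported K _ A (q + 1), divKoszul y (p + 1) w = z := by
  classical
  cases nonempty_fintype κ
  obtain ⟨w, hw, z', -, rfl, -, h⟩ := koszul_exists_reduction
    (fun l => contract (p + 1) (y l)) (fun l => contract p (y l))
    (fun k => divMul b k (p + 1)) (fun k => divMul b k p) (fun k l => b.coord k (y l)) β
    (fun k k' => by simp [hb, Finsupp.single_apply, eq_comm])
    (fun k l x => by rw [contract_divMul_succ, hb]) (fun k k' x h => by
      rw [map_sub]
      rcases eq_or_ne k' k with rfl | hk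
      · rw [hb, contract_divMul_self, sub_self]
      · have h' := h.resolve_left hk
        rw [h', zero_sub, neg_eq_zero, hb, hb]
        rw [hb] at h'
        exact contract_divMul_eq_zero hk h')
    (fun _ _ => contract_comm _ _ _) hβ hz hA Finset.univ
  refine ⟨w, hw, ?_⟩
  have : z' = 0 := by
    ext1 I
    refine eq_zero_of_contract_eq_zero b fun k => ?_
    rw [← hb]
    exact (h k (Finset.mem_univ k) I).2
  rw [this, add_zero]
  rfl

lemma divKoszul_exists_reduction (b : Module.Basis κ K V) (β : κ → Fin e)
    (hb : ∀ k, y (β k) = b k) (hβ : ∀ k, β k ∈ A) {z : Finset (Fin e) → DivPow K V 0}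
    (hA : z ∈ supported K _ A q) :
    ∃ w ∈ supported K _ A (q + 1), ∃ z' ∈ supported K _ A q, z = divKoszul y 0 w + z' ∧
      ∀ k I, β k ∉ I → z' I = 0 := by
  classical
  cases nonempty_fintype κ
  -- Taking zero as the next target makes every chain a cycle; only the information on faces
  -- survives.
  obtain ⟨w, hw, z', hz', h, -, h'⟩ := koszul_exists_reduction (L := PUnit.{1})
    (fun l => contract 0 (y l)) (fun l => 0)
    (fun k => divMul b k 0) (fun k => 0) (fun k l => b.coord k (y l)) β
    (fun k k' => by simp [hb, Finsupp.single_apply, eq_comm])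
    (fun k l x => by rw [contract_divMul_zero]; simp) (fun k k' x h => rfl)
    (fun _ _ => rfl) hβ (Subsingleton.elim _ _) hA Finset.univ
  exact ⟨w, hw, z', hz', h, fun k I => (h' k (Finset.mem_univ k) I).1⟩

end DividedPowers

/-! ### The splice map, Cramer's rule and exactness at the splice -/

section Splice

variable {K : Type u} [Field K] {V : Type v} [AddCommGroup V] [Module K V] {e r : ℕ}

/-- Cramer's rule. The form is a multiple of the determinant, and the k-th coordinate of the sum is
the Laplace expansion of a determinant whose top row repeats the k-th coordinate row. -/
lemma _root_.AlternatingMap.sum_succAbove_smul_eq_zero (b : Module.Basis (Fin r) K V)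
    (ψ : V [⋀^Fin r]→ₗ[K] K) (v : Fin (r + 1) → V) :
    ∑ t : Fin (r + 1), ((-1) ^ (t : ℕ) * ψ (fun i => v (t.succAbove i))) • v t = 0 := by
  rw [ψ.eq_smul_basis_det b]
  refine b.ext_elem fun k => ?_
  rw [map_zero, Finsupp.zero_apply, map_sum, Finsupp.finsetSum_apply]
  let A : Matrix (Fin (r + 1)) (Fin (r + 1)) K :=
    Matrix.of (Fin.cons (fun j => b.repr (v j) k) fun i j => b.repr (v j) i)
  have hA : A.det = 0 := Matrix.det_zero_of_row_eq (i := 0) (j := k.succ) (Fin.succ_ne_zero k).symm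
    (by ext j; simp [A])
  rw [Matrix.det_succ_row_zero] at hA
  have : ∀ j : Fin (r + 1), (A.submatrix Fin.succ j.succAbove).det = b.det fun i => v (j.succAbove i) := by
    intro j
    rw [Module.Basis.det_apply]
    congr 1
  simp only [this] at hA
  rw [← mul_zero (ψ b), ← hA, Finset.mul_sum]
  refine Finset.sum_congr rfl fun t _ => ?_
  simp [A]
  ring

lemma card_filter_lt_orderEmbOfFin {I : Finset (Fin e)} {m : ℕ} (h : I.card = m) (t : Fin m) :
    (I.filter (· < I.orderEmbOfFin h t)).card = t := by
  have : I.filter (· < I.orderEmbOfFin h t) =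
      (Finset.Iio t).map (I.orderEmbOfFin h).toEmbedding := by
    ext j
    simp only [Finset.mem_filter, Finset.mem_map, Finset.mem_Iio]
    constructor
    · rintro ⟨hj, hlt⟩
      rw [← Finset.mem_coe, ← Finset.range_orderEmbOfFin I h] at hj
      obtain ⟨i, rfl⟩ := hj
      exact ⟨i, by simpa using hlt, rfl⟩
    · rintro ⟨i, hi, rfl⟩
      exact ⟨Finset.orderEmbOfFin_mem _ _ _, by simpa using hi⟩
  rw [this, Finset.card_map, Fin.card_Iio]

lemma orderEmbOfFin_erase {I : Finset (Fin e)} (h : I.card = r + 1) (t : Fin (r + 1))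
    (h' : (I.erase (I.orderEmbOfFin h t)).card = r) (i : Fin r) :
    (I.erase (I.orderEmbOfFin h t)).orderEmbOfFin h' i = I.orderEmbOfFin h (t.succAbove i) := by
  have := Finset.orderEmbOfFin_unique h' (f := fun i => I.orderEmbOfFin h (t.succAbove i))
    (fun i => by simp [Fin.succAbove_ne])
    (fun i j hij => by simpa using hij)
  exact (congrFun this i).symm

/-- The value of the alternating form `ψ` on `s(e_J)`, where `s(e_l) = y l`. -/
def faceForm (ψ : V [⋀^Fin r]→ₗ[K] K) (y : Fin e → V) (J : Finset (Fin e)) : K :=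
  if h : J.card = r then ψ fun i => y (J.orderEmbOfFin h i) else 0

lemma faceForm_of_card (ψ : V [⋀^Fin r]→ₗ[K] K) (y : Fin e → V) {J : Finset (Fin e)}
    (h : J.card = r) : faceForm ψ y J = ψ fun i => y (J.orderEmbOfFin h i) := dif_pos h

lemma card_of_faceForm_ne_zero {ψ : V [⋀^Fin r]→ₗ[K] K} {y : Fin e → V} {J : Finset (Fin e)}
    (h : faceForm ψ y J ≠ 0) : J.card = r := by
  by_contra h'
  exact h (dif_neg h')

lemma sum_orderEmbOfFin {M : Type*} [AddCommMonoid M] {I : Finset (Fin e)} {m : ℕ}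
    (h : I.card = m) (f : Fin e → M) : ∑ l ∈ I, f l = ∑ t, f (I.orderEmbOfFin h t) := by
  conv_lhs => rw [← Finset.map_orderEmbOfFin_univ I h, Finset.sum_map]
  rfl

lemma sum_faceForm_smul_eq_zero (b : Module.Basis (Fin r) K V) (ψ : V [⋀^Fin r]→ₗ[K] K)
    (y : Fin e → V) (I : Finset (Fin e)) :
    ∑ l ∈ I, (sgn (K := K) I l * faceForm ψ y (I.erase l)) • y l = 0 := by
  by_cases h : I.card = r + 1
  · rw [sum_orderEmbOfFin h,
      ← AlternatingMap.sum_succAbove_smul_eq_zero b ψ fun t => y (I.orderEmbOfFin h t)]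
    refine Finset.sum_congr rfl fun t _ => ?_
    have h' : (I.erase (I.orderEmbOfFin h t)).card = r := by
      rw [Finset.card_erase_of_mem (Finset.orderEmbOfFin_mem _ _ _), h, Nat.add_sub_cancel]
    rw [sgn, card_filter_lt_orderEmbOfFin, faceForm_of_card _ _ h']
    simp only [orderEmbOfFin_erase]
  · refine Finset.sum_eq_zero fun l hl => ?_
    rw [faceForm, dif_neg, mul_zero, zero_smul]
    rwa [← Nat.add_left_inj (n := 1), Finset.card_erase_add_one hl]

lemma sum_sum_notMem_eq {M : Type*} [AddCommMonoid M] (F : Fin e → Finset (Fin e) → M) :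
    ∑ l, ∑ J with l ∉ J, F l J = ∑ I, ∑ l ∈ I, F l (I.erase l) := by
  rw [Finset.sum_sigma', Finset.sum_sigma']
  refine Finset.sum_bij' (fun x _ => ⟨insert x.1 x.2, x.1⟩) (fun x _ => ⟨x.2, x.1.erase x.2⟩)
    ?_ ?_ ?_ ?_ ?_
  · simp
  · simp
  · rintro ⟨l, J⟩ h
    simp only [Finset.mem_sigma, Finset.mem_filter, Finset.mem_univ, true_and] at h
    simp [h]
  · rintro ⟨I, l⟩ h
    simp only [Finset.mem_sigma, Finset.mem_univ, true_and] at h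
    simp [h]
  · rintro ⟨l, J⟩ h
    simp only [Finset.mem_sigma, Finset.mem_filter, Finset.mem_univ, true_and] at h
    simp [h]

/-- The splice map `D_0 V* ⊗ ⋀ U → U` attached to the form `ψ` and the vectors `y l`. -/
def splice (ψ : V [⋀^Fin r]→ₗ[K] K) (y : Fin e → V) :
    (Finset (Fin e) → DivPow K V 0) →ₗ[K] (Fin e → K) :=
  LinearMap.pi fun l => ∑ J with l ∉ J,
    (sgn (K := K) J l * faceForm ψ y J) • (divPowZero ∘ₗ LinearMap.proj (insert l J))

variable {ψ : V [⋀^Fin r]→ₗ[K] K} {y : Fin e → V}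

lemma splice_apply (z : Finset (Fin e) → DivPow K V 0) (l : Fin e) :
    splice ψ y z l = ∑ J with l ∉ J,
      sgn (K := K) J l * faceForm ψ y J * divPowZero (z (insert l J)) := by
  simp [splice]

lemma sum_splice_smul (b : Module.Basis (Fin r) K V) (z : Finset (Fin e) → DivPow K V 0) :
    ∑ l, splice ψ y z l • y l = 0 := by
  simp only [splice_apply, Finset.sum_smul]
  rw [sum_sum_notMem_eq]
  refine Finset.sum_eq_zero fun I _ => ?_
  have h0 := congrArg (fun v => divPowZero (z I) • v) (sum_faceForm_smul_eq_zero b ψ y I)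
  simp only [smul_zero, Finset.smul_sum] at h0
  rw [← h0]
  refine Finset.sum_congr rfl fun l hl => ?_
  rw [Finset.insert_erase hl, sgn_erase_self, smul_smul, mul_comm]

/-- Fix the coordinate l and regroup by I = J ∪ {k}. Each group is a linear functional on V applied
to the Cramer relation of I. -/
lemma splice_divKoszul (b : Module.Basis (Fin r) K V) (w : Finset (Fin e) → DivPow K V 1) :
    splice ψ y (divKoszul y 0 w) = 0 := by
  ext l
  rw [splice_apply, Pi.zero_apply]
  -- An element of D_1 V* read as a functional on V = S_1 V.
  let g : Finset (Fin e) → V →ₗ[K] K := fun I =>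
    (w (insert l I)) ∘ₗ (SymmetricAlgebra.ι K V).codRestrict (SymPow K V 1) fun v => by
      rw [SymPow, pow_one]; exact LinearMap.mem_range_self _ v
  have hg : ∀ I v, divPowZero (contract 0 v (w (insert l I))) = g I v := fun I v => by
    simp only [divPowZero, LinearMap.applyₗ_apply_apply, contract_apply, g, mul_one]
    rfl
  let F : Fin e → Finset (Fin e) → K := fun k J => if l ∈ insert k J then 0 else
    -(sgn (K := K) J k * faceForm ψ y J * sgn (K := K) (insert k J) l * g (insert k J) (y k))
  have h1 : ∀ J ∈ Finset.univ.filter (fun J => l ∉ J), sgn (K := K) J l * faceForm ψ y J *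
      divPowZero (divKoszul y 0 w (insert l J)) = ∑ k, if k ∈ J then 0 else F k J := by
    intro J hJ
    have hJ : l ∉ J := by simpa using hJ
    rw [divKoszul, koszul_eq_sum, Finset.sum_apply, map_sum, Finset.mul_sum]
    refine Finset.sum_congr rfl fun k _ => ?_
    rw [interior_apply]
    rcases eq_or_ne k l with rfl | hk
    · simp [hJ, F]
    by_cases hkJ : k ∈ J
    · simp [hkJ]
    · simp only [Finset.mem_insert, hk, hkJ, or_self, if_false, hk.symm, hJ, F]
      rw [map_smul, LinearMap.compLeft_apply, Function.comp_apply, Finset.insert_comm, hg,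
        smul_eq_mul]
      have := sgn_mul_sgn_insert (K := K) hJ hkJ hk.symm
      linear_combination (faceForm ψ y J * g (insert k J) (y k)) * this
  rw [Finset.sum_congr rfl h1, Finset.sum_comm]
  have h2 : ∀ k, (∑ J with l ∉ J, if k ∈ J then 0 else F k J) = ∑ J with k ∉ J, F k J := by
    intro k
    rw [Finset.sum_filter, Finset.sum_filter]
    refine Finset.sum_congr rfl fun J _ => ?_
    by_cases hl : l ∈ J <;> by_cases hk : k ∈ J <;> simp [hl, hk, F]
  rw [Finset.sum_congr rfl fun k _ => h2 k, sum_sum_notMem_eq]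
  refine Finset.sum_eq_zero fun I _ => ?_
  by_cases hl : l ∈ I
  · refine Finset.sum_eq_zero fun k hk => ?_
    simp [F, Finset.insert_erase hk, hl]
  · have := congrArg (g I) (sum_faceForm_smul_eq_zero b ψ y I)
    rw [map_zero, map_sum] at this
    rw [← mul_zero (-sgn (K := K) I l), ← this, Finset.mul_sum]
    refine Finset.sum_congr rfl fun k hk => ?_
    simp only [F, Finset.insert_erase hk, hl, if_false, sgn_erase_self, map_smul, smul_eq_mul]
    ring

lemma exists_divPowZero_eq_one : ∃ f : DivPow K V 0, divPowZero f = 1 :=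
  ⟨SymmetricAlgebra.algebraMapInv.toLinearMap ∘ₗ (SymPow K V 0).subtype, by simp [divPowZero]⟩

lemma eq_zero_of_divPowZero_eq_zero {f : DivPow K V 0} (h : divPowZero f = 0) : f = 0 := by
  ext ⟨x, hx⟩
  obtain ⟨t, ht⟩ : ∃ t : K, algebraMap K _ t = x := by
    have hx' := hx
    rw [SymPow, pow_zero] at hx'
    exact Submodule.mem_one.1 hx'
  have : (⟨x, hx⟩ : SymPow K V 0) =
      t • ⟨1, by rw [SymPow, pow_zero]; exact Submodule.one_le.mp le_rfl⟩ := by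
    refine Subtype.ext ?_
    exact ht.symm.trans (Algebra.algebraMap_eq_smul_one t)
  rw [this, map_smul]
  simp only [divPowZero, LinearMap.applyₗ_apply_apply] at h
  rw [h, smul_zero, LinearMap.zero_apply]

variable {A B : Finset (Fin e)}

/-- The basis of `V` consisting of the vectors `y l`, `l ∈ B`, in increasing order. -/
lemma exists_basis_fin (b : Module.Basis B K V) (hB : B.card = r) (hb : ∀ k : B, y k = b k) :
    ∃ b' : Module.Basis (Fin r) K V, ∀ i, b' i = y (B.orderEmbOfFin hB i) :=
  ⟨b.reindex (B.orderIsoOfFin hB).symm.toEquiv, fun i => by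
    rw [Module.Basis.reindex_apply, ← hb]; rfl⟩

lemma faceForm_ne_zero (b : Module.Basis B K V) (hB : B.card = r) (hb : ∀ k : B, y k = b k)
    (hψ : ψ ≠ 0) : faceForm ψ y B ≠ 0 := by
  obtain ⟨b', hb'⟩ := exists_basis_fin b hB hb
  rw [faceForm_of_card _ _ hB]
  intro h
  simp only [← hb'] at h
  apply hψ
  rw [ψ.eq_smul_basis_det b']
  change ψ (fun i => b' i) • _ = _
  rw [h, zero_smul]

lemma splice_exact (b : Module.Basis B K V) (hB : B.card = r) (hb : ∀ k : B, y k = b k)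
    (hψ : ψ ≠ 0) (hBA : B ⊆ A) {z : Finset (Fin e) → DivPow K V 0}
    (hA : z ∈ supported K _ A (r + 1)) (hz : splice ψ y z = 0) :
    ∃ w ∈ supported K _ A (r + 1 + 1), divKoszul y 0 w = z := by
  obtain ⟨w, hw, z', hz', rfl, h⟩ :=
    divKoszul_exists_reduction b (fun k => (k : Fin e)) hb (fun k => hBA k.2) hA
  obtain ⟨b', -⟩ := exists_basis_fin b hB hb
  rw [map_add, splice_divKoszul b', zero_add] at hz
  refine ⟨w, hw, ?_⟩
  suffices z' = 0 by rw [this, add_zero]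
  ext1 I
  by_contra hI
  -- A face carrying the remainder contains B and has r + 1 elements, so it is B ∪ {c}. In
  -- coordinate c of the splice only J = B contributes, with the nonzero factor ±ψ(B).
  have hBI : B ⊆ I := fun k hk => by
    by_contra hkI
    exact hI (h ⟨k, hk⟩ I hkI)
  have hIA : I ⊆ A ∧ I.card = r + 1 := by
    by_contra hIA
    exact hI (hz' I hIA)
  obtain ⟨c, hc, rfl⟩ : ∃ c, c ∉ B ∧ insert c B = I := by
    obtain ⟨c, hc⟩ := Finset.card_eq_one.1 (show (I \ B).card = 1 by
      rw [Finset.card_sdiff_of_subset hBI, hIA.2, hB, Nat.add_sub_cancel_left])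
    have : c ∈ I \ B := by rw [hc]; simp
    refine ⟨c, (Finset.mem_sdiff.1 this).2, ?_⟩
    rw [Finset.insert_eq, ← hc, Finset.sdiff_union_of_subset hBI]
  have := congrFun hz c
  rw [splice_apply, Finset.sum_eq_single B, Pi.zero_apply] at this
  · refine hI (eq_zero_of_divPowZero_eq_zero ?_)
    simpa [sgn_ne_zero, faceForm_ne_zero b hB hb hψ] using this
  · intro J hJ hJB
    by_contra hne
    have h1 : faceForm ψ y J ≠ 0 := fun h0 => hne (by rw [h0, mul_zero, zero_mul])
    have h2 : z' (insert c J) ≠ 0 := fun h0 => hne (by rw [h0, map_zero, mul_zero])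
    refine hJB (Finset.eq_of_subset_of_card_le (fun k hk => ?_) ?_).symm
    · by_contra hkJ
      refine h2 (h ⟨k, hk⟩ _ ?_)
      simp only [Finset.mem_insert, hkJ, or_false]
      rintro rfl
      exact hc hk
    · rw [hB, card_of_faceForm_ne_zero h1]
  · intro h0
    simp [hc] at h0

/-- A relation among the y l is determined by its coordinates outside B. Those are matched by
placing a suitable multiple of u c on each face B ∪ {c}; the difference is then a relation among
basis vectors. -/
lemma exists_splice_eq (b : Module.Basis B K V) (hB : B.card = r) (hb : ∀ k : B, y k = b k)
    (hψ : ψ ≠ 0) (hBA : B ⊆ A) {u : Fin e → K} (hA : ∀ l ∉ A, u l = 0)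
    (hu : ∑ l, u l • y l = 0) :
    ∃ z ∈ supported K _ A (r + 1), splice ψ y z = u := by
  obtain ⟨o, ho⟩ := exists_divPowZero_eq_one (K := K) (V := V)
  have hΨ := faceForm_ne_zero b hB hb hψ
  obtain ⟨b', -⟩ := exists_basis_fin b hB hb
  have hins : ∀ c ∉ B, ∀ c', insert c B = insert c' B → c = c' := fun c hc c' h => by
    have : c ∈ insert c' B := h ▸ Finset.mem_insert_self _ _
    exact (Finset.mem_insert.1 this).resolve_right hc
  let z : Finset (Fin e) → DivPow K V 0 := fun I => ∑ c ∈ A \ B,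
    if insert c B = I then (u c * (sgn (K := K) B c * (faceForm ψ y B)⁻¹)) • o else 0
  have hz0 : ∀ I, (∀ c ∈ A \ B, insert c B ≠ I) → z I = 0 := fun I h =>
    Finset.sum_eq_zero fun c hc => if_neg (h c hc)
  have hz1 : ∀ c ∈ A \ B, z (insert c B) =
      (u c * (sgn (K := K) B c * (faceForm ψ y B)⁻¹)) • o := fun c hc => by
    have hcB := (Finset.mem_sdiff.1 hc).2
    simp only [z]
    rw [Finset.sum_eq_single c, if_pos rfl]
    · exact fun c' _ hne => if_neg fun h => hne (hins c hcB c' h.symm).symm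
    · exact fun h => absurd hc h
  have hsp : ∀ c ∉ B, splice ψ y z c = u c := by
    intro c hc
    rw [splice_apply, Finset.sum_eq_single B]
    · by_cases hcA : c ∈ A
      · rw [hz1 c (Finset.mem_sdiff.2 ⟨hcA, hc⟩), map_smul, ho, smul_eq_mul, mul_one]
        have := sgn_mul_self (K := K) B c
        field_simp
        linear_combination u c * this
      · rw [hz0, map_zero, mul_zero, hA c hcA]
        intro c' hc' h
        exact hcA (hins c hc c' h.symm ▸ (Finset.mem_sdiff.1 hc').1)
    · intro J hJ hJB
      have hcJ : c ∉ J := by simpa using hJ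
      rw [hz0, map_zero, mul_zero]
      intro c' hc' h
      have hcc : c = c' := by
        have : c ∈ insert c' B := h ▸ Finset.mem_insert_self _ _
        exact (Finset.mem_insert.1 this).resolve_right hc
      subst hcc
      have := congrArg (fun I => Finset.erase I c) h
      simp only [Finset.erase_insert hc, Finset.erase_insert hcJ] at this
      exact hJB this.symm
    · simp [hc]
  refine ⟨z, fun I hI => hz0 I fun c hc h => hI ?_, ?_⟩
  · obtain ⟨h1, h2⟩ := Finset.mem_sdiff.1 hc
    rw [← h]
    exact ⟨Finset.insert_subset h1 hBA, by rw [Finset.card_insert_of_notMem h2, hB]⟩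
  · have hs := sum_splice_smul (ψ := ψ) (y := y) b' z
    have hd : ∑ l, (splice ψ y z l - u l) • y l = 0 := by
      simp only [sub_smul, Finset.sum_sub_distrib, hs, hu, sub_zero]
    rw [← Finset.sum_subset (Finset.subset_univ B) fun l _ hl => by
      rw [hsp l hl, sub_self, zero_smul], ← Finset.sum_coe_sort] at hd
    simp only [hb] at hd
    have := Fintype.linearIndependent_iff.1 b.linearIndependent
      (fun k => splice ψ y z k - u k) hd
    ext l
    by_cases hl : l ∈ B
    · exact sub_eq_zero.1 (this ⟨l, hl⟩)
    · exact hsp l hl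

end Splice

/-! ### Exactness of one strand versus maximal rank -/

section MaximalRank

variable {K : Type u} [Field K] {V : Type v} [AddCommGroup V] [Module K V]
  {e r : ℕ} {y : Fin e → V} {ψ : V [⋀^Fin r]→ₗ[K] K}
  {A : Finset (Fin e)}

lemma exists_basis_subset (hr : Module.finrank K V = r)
    (hA : Submodule.span K (y '' A) = ⊤) :
    ∃ B ⊆ A, ∃ b : Module.Basis B K V, B.card = r ∧ ∀ k : B, y k = b k := by
  classical
  obtain ⟨B, hBA, -, hsp, hli⟩ := exists_linearIndepOn_extension (K := K) (v := y)
    (s := ∅) (t := (A : Set (Fin e))) (linearIndepOn_empty _ _) (Set.empty_subset _)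
  lift B to Finset (Fin e) using Set.toFinite B
  have h1 : ⊤ ≤ Submodule.span K (Set.range fun k : B => y k) := by
    rw [← hA, Submodule.span_le]
    convert hsp using 3
    ext; simp
  refine ⟨B, by simpa using hBA, Module.Basis.mk hli h1, ?_, fun k => by simp⟩
  rw [← hr, Module.finrank_eq_card_basis (Module.Basis.mk hli h1)]
  simp

lemma supported_eq_bot {M : Type*} [AddCommGroup M] [Module K M] {q : ℕ} (h : A.card < q) :
    supported K M A q = ⊥ := by
  rw [Submodule.eq_bot_iff]
  intro z hz
  ext1 I
  refine hz I fun hI => ?_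
  have := Finset.card_le_card hI.1
  omega

variable [FiniteDimensional K V]

lemma span_eq_top_or_linearIndepOn
    (h : Module.finrank K (Submodule.span K (y '' A)) = min (Module.finrank K V) A.card) :
    Submodule.span K (y '' A) = ⊤ ∨
      (A.card < Module.finrank K V ∧ LinearIndepOn K y (A : Set (Fin e))) := by
  rcases le_or_gt (Module.finrank K V) A.card with hle | hlt
  · exact Or.inl (Submodule.eq_top_of_finrank_eq (by rw [h, min_eq_left hle]))
  · refine Or.inr ⟨hlt, ?_⟩
    rw [LinearIndepOn, linearIndependent_iff_card_eq_finrank_span, Set.finrank]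
    rw [min_eq_right hlt.le] at h
    rw [← Set.image_eq_range, h]
    simp

lemma divKoszul_exact_of_finrank (hr : Module.finrank K V = r)
    (h : Module.finrank K (Submodule.span K (y '' A)) = min r A.card) {p : ℕ}
    {z : Finset (Fin e) → DivPow K V (p + 1)} (hA : z ∈ supported K _ A (r + 1 + (p + 1)))
    (hz : divKoszul y p z = 0) :
    ∃ w ∈ supported K _ A (r + 1 + (p + 1 + 1)), divKoszul y (p + 1) w = z := by
  subst hr
  rcases span_eq_top_or_linearIndepOn h with h | ⟨hlt, -⟩
  · obtain ⟨B, hBA, b, -, hb⟩ := exists_basis_subset rfl h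
    exact divKoszul_exact b (fun k => (k : Fin e)) hb (fun k => hBA k.2) hz hA
  · rw [supported_eq_bot (by omega)] at hA
    exact ⟨0, Submodule.zero_mem _, by rw [(Submodule.mem_bot K).1 hA, map_zero]⟩

lemma splice_exact_of_finrank (hr : Module.finrank K V = r) (hψ : ψ ≠ 0)
    (h : Module.finrank K (Submodule.span K (y '' A)) = min r A.card)
    {z : Finset (Fin e) → DivPow K V 0} (hA : z ∈ supported K _ A (r + 1))
    (hz : splice ψ y z = 0) :
    ∃ w ∈ supported K _ A (r + 1 + 1), divKoszul y 0 w = z := by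
  subst hr
  rcases span_eq_top_or_linearIndepOn h with h | ⟨hlt, -⟩
  · obtain ⟨B, hBA, b, hB, hb⟩ := exists_basis_subset rfl h
    exact splice_exact b hB hb hψ hBA hA hz
  · rw [supported_eq_bot (by omega)] at hA
    exact ⟨0, Submodule.zero_mem _, by rw [(Submodule.mem_bot K).1 hA, map_zero]⟩

lemma exists_splice_eq_of_finrank (hr : Module.finrank K V = r) (hψ : ψ ≠ 0)
    (h : Module.finrank K (Submodule.span K (y '' A)) = min r A.card)
    {u : Fin e → K} (hA : ∀ l ∉ A, u l = 0) (hu : ∑ l, u l • y l = 0) :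
    ∃ z ∈ supported K _ A (r + 1), splice ψ y z = u := by
  subst hr
  rcases span_eq_top_or_linearIndepOn h with h | ⟨-, hli⟩
  · obtain ⟨B, hBA, b, hB, hb⟩ := exists_basis_subset rfl h
    exact exists_splice_eq b hB hb hψ hBA hA hu
  · refine ⟨0, Submodule.zero_mem _, ?_⟩
    rw [← Finset.sum_subset (Finset.subset_univ A) fun l _ hl => by rw [hA l hl, zero_smul]] at hu
    have := linearIndepOn_finset_iff.1 hli u hu
    ext l
    by_cases hl : l ∈ A
    · simp [this l hl]
    · simp [hA l hl]

/-- If the vectors indexed by A are dependent, a nontrivial relation is an image under the splice. A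
nonzero coordinate of it exhibits an r-element J ⊆ A on which the alternating form does not vanish,
so the span has dimension r. -/
lemma finrank_span_eq_min (hr : Module.finrank K V = r)
    (h : ∀ u : Fin e → K, (∀ l ∉ A, u l = 0) → ∑ l, u l • y l = 0 →
      ∃ z ∈ supported K _ A (r + 1), splice ψ y z = u) :
    Module.finrank K (Submodule.span K (y '' A)) = min r A.card := by
  classical
  have hle1 : Module.finrank K (Submodule.span K (y '' A)) ≤ r := hr ▸ Submodule.finrank_le _
  have hcard : Module.finrank K (Submodule.span K (y '' A)) ≤ A.card := by
    rw [← Finset.coe_image]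
    exact (finrank_span_finset_le_card _).trans Finset.card_image_le
  by_cases hli : LinearIndepOn K y (A : Set (Fin e))
  · have := linearIndependent_iff_card_eq_finrank_span.1 hli
    rw [Set.finrank, ← Set.image_eq_range] at this
    simp only [Finset.coe_sort_coe, Fintype.card_coe] at this
    omega
  · refine le_antisymm (le_min hle1 hcard) ((min_le_left _ _).trans ?_)
    rw [linearIndepOn_finset_iff] at hli
    push Not at hli
    obtain ⟨g, hg, l, hl, hgl⟩ := hli
    obtain ⟨z, hz, hzu⟩ := h (fun l => if l ∈ A then g l else 0) (fun l hl => if_neg hl) (by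
      rw [← hg, ← Finset.sum_subset (Finset.subset_univ A) fun l _ hl => by
        rw [if_neg hl, zero_smul]]
      exact Finset.sum_congr rfl fun l hl => by rw [if_pos hl])
    have hne : splice ψ y z l ≠ 0 := by rw [hzu]; simpa [hl] using hgl
    rw [splice_apply] at hne
    obtain ⟨J, -, hJ⟩ := Finset.exists_ne_zero_of_sum_ne_zero hne
    have h1 : faceForm ψ y J ≠ 0 := fun h0 => hJ (by rw [h0, mul_zero, zero_mul])
    have h2 : z (insert l J) ≠ 0 := fun h0 => hJ (by rw [h0, map_zero, mul_zero])
    have hJA : J ⊆ A := by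
      by_contra hJA
      exact h2 (hz _ fun h => hJA ((Finset.subset_insert _ _).trans h.1))
    have hJr := card_of_faceForm_ne_zero h1
    rw [faceForm_of_card _ _ hJr] at h1
    have hind : LinearIndependent K fun i => y (J.orderEmbOfFin hJr i) := by
      by_contra hdep
      exact h1 (ψ.map_linearDependent _ hdep)
    have hfr := finrank_span_eq_card hind
    rw [Fintype.card_fin] at hfr
    rw [← hfr]
    refine Submodule.finrank_mono (Submodule.span_mono ?_)
    rintro _ ⟨i, rfl⟩
    exact ⟨_, hJA (Finset.orderEmbOfFin_mem _ _ _), rfl⟩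

end MaximalRank

/-! ### Coefficients of elements of Q ⊗ M -/

section TensorCoeff

variable {K : Type*} [Field K] {n : ℕ} {M M' D D' : Type*} [AddCommMonoid M] [Module K M]
  [AddCommMonoid M'] [Module K M'] [AddCommGroup D] [Module K D] [AddCommGroup D'] [Module K D']

/-- The family of coefficients of an element of `K[x₁,…,xₙ] ⊗ M`. -/
def tensorCoeff (τ : M ≃ₗ[K] D) : Poly K n ⊗[K] M ≃ₗ[K] ((Fin n →₀ ℕ) →₀ D) :=
  TensorProduct.equivFinsuppOfBasisLeft (MvPolynomial.basisMonomials (Fin n) K) ≪≫ₗ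
    Finsupp.mapRange.linearEquiv τ

lemma tensorCoeff_tmul (τ : M ≃ₗ[K] D) (P : Poly K n) (m : M) (ν : Fin n →₀ ℕ) :
    tensorCoeff τ (P ⊗ₜ m) ν = P.coeff ν • τ m := by
  simp only [tensorCoeff, LinearEquiv.trans_apply, Finsupp.mapRange.linearEquiv_apply,
    Finsupp.mapRange_apply, TensorProduct.equivFinsuppOfBasisLeft_apply_tmul_apply,
    map_smul]
  rfl

lemma tensorCoeff_monomial_smul_baseChange (τ : M ≃ₗ[K] D) (τ' : M' ≃ₗ[K] D') (f : M →ₗ[K] M')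
    (g : D →ₗ[K] D') (h : ∀ m, τ' (f m) = g (τ m)) (μ ν : Fin n →₀ ℕ) (x : Poly K n ⊗[K] M) :
    tensorCoeff τ' ((MvPolynomial.monomial μ (1 : K) : Poly K n) • f.baseChange (Poly K n) x) ν =
      if μ ≤ ν then g (tensorCoeff τ x (ν - μ)) else 0 := by
  induction x using TensorProduct.induction_on with
  | zero => simp
  | tmul P m =>
    rw [LinearMap.baseChange_tmul, TensorProduct.smul_tmul', tensorCoeff_tmul, tensorCoeff_tmul,
      smul_eq_mul, MvPolynomial.coeff_monomial_mul', one_mul, h]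
    split_ifs <;> simp
  | add x y hx hy =>
    rw [map_add, smul_add, map_add, Finsupp.add_apply, hx, hy]
    split_ifs <;> simp

lemma coeff_rid_baseChange (τ : M ≃ₗ[K] D) (f : M →ₗ[K] K) (g : D →ₗ[K] K)
    (h : ∀ m, f m = g (τ m)) (ν : Fin n →₀ ℕ) (x : Poly K n ⊗[K] M) :
    (TensorProduct.AlgebraTensorModule.rid K (Poly K n) (Poly K n)
      (f.baseChange (Poly K n) x)).coeff ν = g (tensorCoeff τ x ν) := by
  induction x using TensorProduct.induction_on with
  | zero => simp
  | tmul P m =>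
    rw [LinearMap.baseChange_tmul, TensorProduct.AlgebraTensorModule.rid_tmul, tensorCoeff_tmul,
      MvPolynomial.coeff_smul, h, map_smul, smul_eq_mul, smul_eq_mul, mul_comm]
  | add x y hx hy => simp only [map_add, MvPolynomial.coeff_add, hx, hy, Finsupp.add_apply]

end TensorCoeff

/-! ### Strands of the Taylor complex and its Koszul differentials -/

section Strand

variable {K : Type u} [Field K] {n e r : ℕ} {V : Type v} [AddCommGroup V] [Module K V]
  {s : (Fin e → K) →ₗ[K] V} {deg : Fin e → (Fin n →₀ ℕ)}

/-- The vertices of degree at most `a`. -/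
def verticesLE (deg : Fin e → (Fin n →₀ ℕ)) (a : Fin n →₀ ℕ) : Finset (Fin e) := by
  classical exact Finset.univ.filter fun j => deg j ≤ a

lemma mem_verticesLE {a : Fin n →₀ ℕ} {j : Fin e} : j ∈ verticesLE deg a ↔ deg j ≤ a := by
  simp [verticesLE]

lemma subset_verticesLE {a : Fin n →₀ ℕ} {I : Finset (Fin e)} :
    I ⊆ verticesLE deg a ↔ faceDeg deg I ≤ a := by
  rw [faceDeg, Finset.sup_le_iff]
  exact forall₂_congr fun j _ => mem_verticesLE

/-- The trivialisation of the coefficients of the full system by a generator of `⋀^r V*`. -/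
def fullCoeff (s : (Fin e → K) →ₗ[K] V) (θ : ExtDual K V r ≃ₗ[K] K) (p : ℕ)
    (I : Face e (r + 1 + p)) :
    ((fullSystem s r).F p I ⊗[K] ExtDual K V r) ≃ₗ[K] DivPow K V p :=
  TensorProduct.congr (LinearEquiv.ofTop _ rfl) θ ≪≫ₗ TensorProduct.rid K _

lemma fullCoeff_tmul (θ : ExtDual K V r ≃ₗ[K] K) (p : ℕ) (I : Face e (r + 1 + p))
    (f : (fullSystem s r).F p I) (ω : ExtDual K V r) :
    fullCoeff s θ p I (f ⊗ₜ ω) = θ ω • (f : DivPow K V p) := by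
  simp only [fullCoeff, LinearEquiv.trans_apply, TensorProduct.congr_tmul, TensorProduct.rid_tmul]
  rfl

lemma fullCoeff_comp (θ : ExtDual K V r ≃ₗ[K] K) (p : ℕ) (I : Face e (r + 1 + (p + 1)))
    (J : Face e (r + 1 + p)) (m : (fullSystem s r).F (p + 1) I ⊗[K] ExtDual K V r) :
    fullCoeff s θ p J ((fullSystem s r).comp p I J m) =
      koszulComp s p I.1 J.1 (fullCoeff s θ (p + 1) I m) := by
  induction m using TensorProduct.induction_on with
  | zero => simp
  | tmul f ω =>
    rw [fullCoeff_tmul, System.comp, LinearMap.rTensor_tmul, fullCoeff_tmul, map_smul]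
    rfl
  | add x y hx hy => simp only [map_add, hx, hy]

/-- The strand of degree `a` of an element of a term of the Taylor complex. -/
def strand (θ : ExtDual K V r ≃ₗ[K] K) (deg : Fin e → (Fin n →₀ ℕ)) {p : ℕ}
    (a : Fin n →₀ ℕ) (z : (fullSystem s r).Term n p) (I : Finset (Fin e)) : DivPow K V p :=
  if h : I.card = r + 1 + p ∧ faceDeg deg I ≤ a then
    tensorCoeff (fullCoeff s θ p ⟨I, h.1⟩) (z ⟨I, h.1⟩) (a - faceDeg deg I) else 0

variable {θ : ExtDual K V r ≃ₗ[K] K} {p : ℕ}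

lemma strand_apply_of_le {a : Fin n →₀ ℕ} {I : Finset (Fin e)} (h1 : I.card = r + 1 + p)
    (h2 : faceDeg deg I ≤ a) (z : (fullSystem s r).Term n p) :
    strand θ deg a z I =
      tensorCoeff (fullCoeff s θ p ⟨I, h1⟩) (z ⟨I, h1⟩) (a - faceDeg deg I) :=
  dif_pos ⟨h1, h2⟩

lemma strand_mem_supported (a : Fin n →₀ ℕ) (z : (fullSystem s r).Term n p) :
    strand θ deg a z ∈ supported K _ (verticesLE deg a) (r + 1 + p) := fun I hI => by
  rw [strand, dif_neg]
  rwa [and_comm, ← subset_verticesLE]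

/-- Multiplication by x^(|e_I| - |e_J|) exactly compensates the different shifts at which the
coefficients of I and J are read. -/
lemma strand_d (a : Fin n →₀ ℕ) (z : (fullSystem s r).Term n (p + 1)) :
    strand θ deg a ((fullSystem s r).d deg p z) =
      divKoszul (fun l => s (Pi.single l 1)) p (strand θ deg a z) := by
  ext1 J
  by_cases hJ : J ⊆ verticesLE deg a ∧ J.card = r + 1 + p
  swap
  · rw [strand_mem_supported a _ J hJ, divKoszul,
      koszul_mem_supported (q := r + 1 + p) _ (strand_mem_supported a z) J hJ]
  obtain ⟨hJa, hJc⟩ := hJ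
  rw [subset_verticesLE] at hJa
  rw [strand_apply_of_le hJc hJa]
  have hd : (fullSystem s r).d deg p z ⟨J, hJc⟩ = ∑ I : Face e (r + 1 + (p + 1)),
      (MvPolynomial.monomial (faceDeg deg I.1 - faceDeg deg J) (1 : K) : Poly K n) •
      (((fullSystem s r).comp p I ⟨J, hJc⟩).baseChange (Poly K n) (z I)) := by
    simp [System.d]
  have hI : ∀ I : Face e (r + 1 + (p + 1)), tensorCoeff (fullCoeff s θ p ⟨J, hJc⟩)
      ((MvPolynomial.monomial (faceDeg deg I.1 - faceDeg deg J) (1 : K) : Poly K n) •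
      (((fullSystem s r).comp p I ⟨J, hJc⟩).baseChange (Poly K n) (z I))) (a - faceDeg deg J) =
      ∑ l, if l ∈ I.1 ∧ I.1.erase l = J then
        sgn (K := K) J l • contract p (s (Pi.single l 1)) (strand θ deg a z I.1) else 0 := by
    intro I
    rw [tensorCoeff_monomial_smul_baseChange (fullCoeff s θ (p + 1) I) _ _ _
      (fullCoeff_comp θ p I ⟨J, hJc⟩)]
    -- Although subtraction is truncated, this amounts to |e_I| ≤ a because |e_J| ≤ a.
    by_cases hIa : faceDeg deg I.1 - faceDeg deg J ≤ a - faceDeg deg J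
    · rw [if_pos hIa, koszulComp, LinearMap.sum_apply, ← Finset.univ_inter I.1,
        ← Finset.sum_ite_mem, Finset.univ_inter]
      refine Finset.sum_congr rfl fun l _ => ?_
      by_cases hl : l ∈ I.1
      swap
      · simp [hl]
      by_cases hl' : I.1.erase l = J
      swap
      · simp [hl, hl']
      have hJI : faceDeg deg J ≤ faceDeg deg I.1 := by
        rw [← hl']
        exact Finset.sup_mono (Finset.erase_subset _ _)
      have hIa' : faceDeg deg I.1 ≤ a := (tsub_le_tsub_iff_right hJa).1 hIa
      rw [if_pos hl, if_pos hl', if_pos ⟨hl, hl'⟩, strand_apply_of_le I.2 hIa',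
        tsub_tsub_tsub_cancel_right hJI, LinearMap.smul_apply, ← sgn_erase_self, hl']
    · rw [if_neg hIa]
      refine (Finset.sum_eq_zero fun l _ => ?_).symm
      split_ifs with h
      · rw [strand, dif_neg, map_zero, smul_zero]
        exact fun h' => hIa (tsub_le_tsub_right h'.2 _)
      · rfl
  rw [hd, map_sum, Finsupp.finsetSum_apply, Finset.sum_congr rfl fun I _ => hI I, Finset.sum_comm,
    divKoszul, koszul_eq_sum, Finset.sum_apply]
  refine Finset.sum_congr rfl fun l _ => ?_
  rw [interior_apply]
  split_ifs with hl
  · refine Finset.sum_eq_zero fun I _ => if_neg ?_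
    rintro ⟨-, rfl⟩
    simp at hl
  · rw [Finset.sum_eq_single ⟨insert l J, by rw [Finset.card_insert_of_notMem hl, hJc]; rfl⟩]
    · rw [if_pos ⟨Finset.mem_insert_self _ _, Finset.erase_insert hl⟩]
      rfl
    · rintro I - hne
      refine if_neg ?_
      rintro ⟨h1, h2⟩
      exact hne (Subtype.ext ((Finset.insert_erase h1).symm.trans (congrArg (insert l) h2)))
    · simp

end Strand

/-! ### Reconstruction from strands, and the strands of the splice map -/

section Strand

variable {K : Type u} [Field K] {n e r : ℕ} {V : Type v} [AddCommGroup V] [Module K V]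
  {s : (Fin e → K) →ₗ[K] V} {deg : Fin e → (Fin n →₀ ℕ)} {θ : ExtDual K V r ≃ₗ[K] K} {p : ℕ}

lemma strand_zero (a : Fin n →₀ ℕ) :
    strand θ deg a (0 : (fullSystem s r).Term n p) = 0 := by
  ext1 I
  rw [strand]
  split_ifs
  · rw [Pi.zero_apply, map_zero]; rfl
  · rfl

lemma strand_injective {z z' : (fullSystem s r).Term n p}
    (h : ∀ a, strand θ deg a z = strand θ deg a z') : z = z' := by
  ext1 I
  apply (tensorCoeff (fullCoeff s θ p I)).injective
  ext1 ν
  have := congrFun (h (ν + faceDeg deg I.1)) I.1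
  rwa [strand_apply_of_le I.2 le_add_self, strand_apply_of_le I.2 le_add_self,
    add_tsub_cancel_right] at this

lemma exists_strand_eq (w : (Fin n →₀ ℕ) →₀ (Finset (Fin e) → DivPow K V p))
    (hw : ∀ a, w a ∈ supported K _ (verticesLE deg a) (r + 1 + p)) :
    ∃ z : (fullSystem s r).Term n p, ∀ a, strand θ deg a z = w a := by
  refine ⟨fun I => (tensorCoeff (fullCoeff s θ p I)).symm
    ((w.comapDomain (· + faceDeg deg I.1) (add_left_injective _).injOn).mapRange (· I.1) rfl),
    fun a => ?_⟩
  ext1 I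
  by_cases hI : I ⊆ verticesLE deg a ∧ I.card = r + 1 + p
  · have hI' := subset_verticesLE.1 hI.1
    rw [strand_apply_of_le hI.2 hI', LinearEquiv.apply_symm_apply, Finsupp.mapRange_apply,
      Finsupp.comapDomain_apply, tsub_add_cancel_of_le hI']
  · rw [hw a I hI, strand_mem_supported a _ I hI]

lemma finite_strand_ne_zero (z : (fullSystem s r).Term n p) :
    {a | strand θ deg a z ≠ 0}.Finite := by
  classical
  refine (Set.finite_iUnion fun I : Face e (r + 1 + p) =>
    (tensorCoeff (fullCoeff s θ p I) (z I)).support.finite_toSet.image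
      (· + faceDeg deg I.1)).subset fun a ha => ?_
  obtain ⟨I, hI⟩ := Function.ne_iff.1 ha
  by_cases h : I.card = r + 1 + p ∧ faceDeg deg I ≤ a
  · rw [strand_apply_of_le h.1 h.2] at hI
    exact Set.mem_iUnion.2 ⟨⟨I, h.1⟩, a - faceDeg deg I, by simpa using hI,
      tsub_add_cancel_of_le h.2⟩
  · exact absurd (dif_neg h) hI

variable {E : Type w} [AddCommGroup E] [Module (Poly K n) E]

/-- The strand of degree `a` of an element of a free multigraded module. -/
def basisStrand (bE : FreeMultigraded K n e E) (a : Fin n →₀ ℕ) (z : E) (l : Fin e) : K := by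
  classical exact if bE.deg l ≤ a then (bE.basis.repr z l).coeff (a - bE.deg l) else 0

lemma basisStrand_of_le {bE : FreeMultigraded K n e E} {a : Fin n →₀ ℕ} {l : Fin e}
    (h : bE.deg l ≤ a) (z : E) :
    basisStrand bE a z l = (bE.basis.repr z l).coeff (a - bE.deg l) := if_pos h

lemma basisStrand_of_not_le {bE : FreeMultigraded K n e E} {a : Fin n →₀ ℕ} {l : Fin e}
    (h : ¬bE.deg l ≤ a) (z : E) : basisStrand bE a z l = 0 := if_neg h

lemma basisStrand_injective {bE : FreeMultigraded K n e E} {z z' : E}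
    (h : ∀ a, basisStrand bE a z = basisStrand bE a z') : z = z' := by
  apply bE.basis.repr.injective
  ext l ν
  have := congrFun (h (ν + bE.deg l)) l
  rwa [basisStrand_of_le le_add_self, basisStrand_of_le le_add_self, add_tsub_cancel_right] at this

lemma basisStrand_zero (bE : FreeMultigraded K n e E) (a : Fin n →₀ ℕ) :
    basisStrand bE a 0 = 0 := by
  ext l
  simp [basisStrand]

lemma finite_basisStrand_ne_zero (bE : FreeMultigraded K n e E) (z : E) :
    {a | basisStrand bE a z ≠ 0}.Finite := by
  classical
  refine (Set.finite_iUnion fun l : Fin e =>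
    (bE.basis.repr z l).support.finite_toSet.image (· + bE.deg l)).subset fun a ha => ?_
  obtain ⟨l, hl⟩ := Function.ne_iff.1 ha
  by_cases h : bE.deg l ≤ a
  · rw [basisStrand_of_le h] at hl
    exact Set.mem_iUnion.2 ⟨l, a - bE.deg l, by simpa using hl, tsub_add_cancel_of_le h⟩
  · exact absurd (basisStrand_of_not_le h z) hl

lemma exists_basisStrand_eq (bE : FreeMultigraded K n e E) (a : Fin n →₀ ℕ) {u : Fin e → K}
    (hu : ∀ l, ¬bE.deg l ≤ a → u l = 0) :
    ∃ z, basisStrand bE a z = u ∧ ∀ a', a' ≠ a → basisStrand bE a' z = 0 := by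
  classical
  let z : E := bE.basis.equivFun.symm fun l => MvPolynomial.monomial (a - bE.deg l) (u l)
  have hz : ∀ l, bE.basis.repr z l = MvPolynomial.monomial (a - bE.deg l) (u l) := fun l => by
    rw [← Module.Basis.equivFun_apply, LinearEquiv.apply_symm_apply]
  refine ⟨z, ?_, fun a' ha' => ?_⟩
  · ext l
    by_cases h : bE.deg l ≤ a
    · rw [basisStrand_of_le h, hz, MvPolynomial.coeff_monomial, if_pos rfl]
    · rw [basisStrand_of_not_le h, hu l h]
  · ext l
    by_cases h : bE.deg l ≤ a'
    · rw [basisStrand_of_le h, hz, MvPolynomial.coeff_monomial, Pi.zero_apply, ite_eq_right_iff]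
      intro heq
      refine hu l fun h' => ha' ?_
      rw [← tsub_add_cancel_of_le h, ← heq, tsub_add_cancel_of_le h']
    · rw [basisStrand_of_not_le h, Pi.zero_apply]

/-- The alternating form on `V` attached to a trivialisation of `⋀^r V*`. -/
def volumeForm (θ : ExtDual K V r ≃ₗ[K] K) : V [⋀^Fin r]→ₗ[K] K :=
  (exteriorPower.pairingDual K V r (θ.symm 1)).compAlternatingMap (exteriorPower.ιMulti K r)

/-- The wedge of the dual basis is a multiple of the chosen generator and pairs to 1 with the wedge
of the basis. -/
lemma volumeForm_ne_zero (b : Module.Basis (Fin r) K V) (θ : ExtDual K V r ≃ₗ[K] K) :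
    volumeForm θ ≠ 0 := by
  intro h
  have h1 := exteriorPower.pairingDual_ιMulti_ιMulti b.coord b
  set ω := exteriorPower.ιMulti K r b.coord
  have h2 : ω = θ ω • θ.symm 1 := by
    apply θ.injective
    simp
  have h3 : exteriorPower.pairingDual K V r (θ.symm 1) (exteriorPower.ιMulti K r b) = 0 :=
    congrArg (fun ψ : V [⋀^Fin r]→ₗ[K] K => ψ b) h
  rw [h2, map_smul, LinearMap.smul_apply, h3, smul_zero] at h1
  have h4 : (Matrix.of fun i j => b.coord j (b i)) = 1 := by
    ext i j
    simp [Matrix.one_apply, Finsupp.single_apply]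
  rw [h4, Matrix.det_one] at h1
  exact zero_ne_one h1

lemma spliceComp_eq (J : Face e (r + 1)) (t : Fin (r + 1))
    (m : (fullSystem s r).F 0 J ⊗[K] ExtDual K V r) :
    spliceComp s J t (((fullSystem s r).F 0 J).subtype.rTensor _ m) =
      (sgn (K := K) J.1 (J.1.orderEmbOfFin J.2 t) *
        faceForm (volumeForm θ) (fun l => s (Pi.single l 1))
          (J.1.erase (J.1.orderEmbOfFin J.2 t))) *
        divPowZero (fullCoeff s θ 0 J m) := by
  have hc : (J.1.erase (J.1.orderEmbOfFin J.2 t)).card = r := by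
    rw [Finset.card_erase_of_mem (Finset.orderEmbOfFin_mem _ _ _), J.2, Nat.add_sub_cancel]
  induction m using TensorProduct.induction_on with
  | zero => simp
  | tmul f ω =>
    have hω : ω = θ ω • θ.symm 1 := by
      apply θ.injective
      simp
    rw [fullCoeff_tmul, map_smul, LinearMap.rTensor_tmul, faceForm_of_card _ _ hc]
    simp only [orderEmbOfFin_erase]
    conv_lhs => rw [hω]
    simp only [spliceComp, LinearMap.smul_apply, LinearMap.comp_apply, TensorProduct.map_tmul,
      LinearMap.applyₗ_apply_apply, map_smul, LinearMap.mul'_apply, smul_eq_mul]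
    simp only [volumeForm, LinearMap.compAlternatingMap_apply, Submodule.subtype_apply]
    ring
  | add x y hx hy => simp only [map_add, hx, hy, mul_add]

lemma basisStrand_dTwo (bE : FreeMultigraded K n e E) (a : Fin n →₀ ℕ)
    (z : (fullSystem s r).Term n 0) :
    basisStrand bE a ((fullSystem s r).dTwo bE z) =
      splice (volumeForm θ) (fun l => s (Pi.single l 1)) (strand θ bE.deg a z) := by
  classical
  set ψ := volumeForm θ
  set y : Fin e → V := fun l => s (Pi.single l 1) with hy
  ext l
  -- The contribution of the face I to the coordinate l; both sides are expanded into these.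
  let H : Finset (Fin e) → K := fun I => if l ∈ I then
    (sgn (K := K) I l * faceForm ψ y (I.erase l)) * divPowZero (strand θ bE.deg a z I) else 0
  have hR : splice ψ y (strand θ bE.deg a z) l = ∑ J : Face e (r + 1), H J.1 := by
    have h1 : splice ψ y (strand θ bE.deg a z) l = ∑ I, H I := by
      rw [splice_apply, ← Finset.sum_filter]
      refine Finset.sum_bij' (fun J _ => insert l J) (fun I _ => I.erase l) ?_ ?_ ?_ ?_ ?_
      · simp
      · simp
      · intro J hJ
        exact Finset.erase_insert (by simpa using hJ)
      · intro J hJ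
        exact Finset.insert_erase (by simpa using hJ)
      · intro J hJ
        rw [sgn_insert_self, Finset.erase_insert (by simpa using hJ)]
    rw [h1, ← Finset.sum_subset (Finset.subset_univ (Finset.univ.filter fun I => I.card = r + 1)),
      ← Finset.sum_subtype_eq_sum_filter, Finset.subtype_univ]
    intro I _ hI
    simp only [Finset.mem_filter, Finset.mem_univ, true_and] at hI
    simp only [H]
    rw [strand_mem_supported a z I fun h => hI h.2, map_zero, mul_zero, ite_self]
  have hrepr : bE.basis.repr ((fullSystem s r).dTwo bE z) l =
      ∑ J : Face e (r + 1), ∑ t : Fin (r + 1), if J.1.orderEmbOfFin J.2 t = l then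
        (MvPolynomial.monomial (faceDeg bE.deg J.1 - bE.deg l) (1 : K) : Poly K n) *
          TensorProduct.AlgebraTensorModule.rid K (Poly K n) (Poly K n)
            ((spliceComp s J t ∘ₗ ((fullSystem s r).F 0 J).subtype.rTensor _).baseChange
              (Poly K n) (z J)) else 0 := by
    rw [System.dTwo]
    simp only [LinearMap.sum_apply, map_sum, Finsupp.finsetSum_apply]
    refine Finset.sum_congr rfl fun J _ => Finset.sum_congr rfl fun t _ => ?_
    simp only [LinearMap.smul_apply, LinearMap.comp_apply, LinearMap.proj_apply, map_smul,
      LinearMap.toSpanSingleton_apply, LinearEquiv.coe_coe, Finsupp.smul_apply,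
      Module.Basis.repr_self, smul_eq_mul]
    split_ifs with h
    · rw [h, Finsupp.single_eq_same, mul_one]
    · rw [Finsupp.single_eq_of_ne (Ne.symm h), mul_zero, mul_zero]
  rw [hR]
  by_cases hl : bE.deg l ≤ a
  · rw [basisStrand_of_le hl, hrepr]
    simp only [MvPolynomial.coeff_sum]
    refine Finset.sum_congr rfl fun J _ => ?_
    by_cases hlJ : l ∈ J.1
    · obtain ⟨t, ht⟩ : ∃ t, J.1.orderEmbOfFin J.2 t = l := by
        rwa [← Finset.mem_coe, ← Finset.range_orderEmbOfFin J.1 J.2] at hlJ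
      rw [Finset.sum_eq_single t, if_pos ht, MvPolynomial.coeff_monomial_mul', one_mul,
        coeff_rid_baseChange (fullCoeff s θ 0 J) _
          ((sgn (K := K) J.1 l * faceForm ψ y (J.1.erase l)) • divPowZero)]
      · simp only [H, hlJ, if_true]
        have hle : bE.deg l ≤ faceDeg bE.deg J.1 := Finset.le_sup hlJ
        rw [tsub_tsub_tsub_cancel_right hle]
        split_ifs with h
        · rw [strand_apply_of_le J.2 ((tsub_le_tsub_iff_right hl).1 h)]
          rfl
        · rw [strand, dif_neg (fun h' => h (tsub_le_tsub_right h'.2 _)), map_zero, mul_zero]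
      · intro m
        rw [← ht]
        exact spliceComp_eq J t m
      · intro t' _ hne
        rw [if_neg, MvPolynomial.coeff_zero]
        exact fun h => hne ((J.1.orderEmbOfFin J.2).injective (h.trans ht.symm))
      · simp
    · simp only [H, hlJ, if_false]
      refine Finset.sum_eq_zero fun t _ => ?_
      rw [if_neg, MvPolynomial.coeff_zero]
      rintro rfl
      exact hlJ (Finset.orderEmbOfFin_mem _ _ _)
  · rw [basisStrand_of_not_le hl]
    refine (Finset.sum_eq_zero fun J _ => ?_).symm
    simp only [H]
    split_ifs with h
    · rw [strand_mem_supported a z J.1, map_zero, mul_zero]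
      exact fun h' => hl (mem_verticesLE.1 (h'.1 h))
    · rfl

end Strand

/-! ### Invariance of rank under extension of scalars -/

section Rank

/-- Factor C = P S through its column space, with P split injective and S split surjective. The
factorisation bounds the rank over R from above, and P' C S' = 1, which survives base change, bounds
it from below. -/
lemma _root_.Matrix.rank_map_algebraMap {K R m n : Type*} [Field K] [CommRing R] [Nontrivial R]
    [Algebra K R] [Fintype m] [Fintype n] (C : Matrix m n K) :
    (C.map (algebraMap K R)).rank = C.rank := by
  classical
  let V := LinearMap.range C.mulVecLin
  let b : Module.Basis (Fin C.rank) K V := Module.finBasisOfFinrankEq K V rfl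
  obtain ⟨σ, hσ⟩ := (C.mulVecLin.rangeRestrict).exists_rightInverse_of_surjective
    (LinearMap.range_rangeRestrict _)
  obtain ⟨τ, hτ⟩ := V.subtype.exists_leftInverse_of_injective V.ker_subtype
  let P : Matrix m (Fin C.rank) K := LinearMap.toMatrix' (V.subtype ∘ₗ b.equivFun.symm.toLinearMap)
  let P' : Matrix (Fin C.rank) m K := LinearMap.toMatrix' (b.equivFun.toLinearMap ∘ₗ τ)
  let S : Matrix (Fin C.rank) n K :=
    LinearMap.toMatrix' (b.equivFun.toLinearMap ∘ₗ C.mulVecLin.rangeRestrict)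
  let S' : Matrix n (Fin C.rank) K := LinearMap.toMatrix' (σ ∘ₗ b.equivFun.symm.toLinearMap)
  have hC : P * S = C := by
    rw [← LinearMap.toMatrix'_comp]
    conv_rhs => rw [← LinearMap.toMatrix'_toLin' C]
    congr 1
    ext u i
    simp [Matrix.toLin'_apply']
  have hP : P' * P = 1 := by
    rw [← LinearMap.toMatrix'_comp, ← LinearMap.toMatrix'_id]
    congr 1
    refine LinearMap.ext fun u => ?_
    have := LinearMap.congr_fun hτ (b.equivFun.symm u)
    simp only [LinearMap.comp_apply, LinearMap.id_apply, LinearEquiv.coe_coe] at this ⊢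
    rw [this, LinearEquiv.apply_symm_apply]
  have hS : S * S' = 1 := by
    rw [← LinearMap.toMatrix'_comp, ← LinearMap.toMatrix'_id]
    congr 1
    refine LinearMap.ext fun u => ?_
    have := LinearMap.congr_fun hσ (b.equivFun.symm u)
    simp only [LinearMap.comp_apply, LinearMap.id_apply, LinearEquiv.coe_coe] at this ⊢
    rw [this, LinearEquiv.apply_symm_apply]
  have h1 : P' * C * S' = 1 := by
    have : P' * (P * S) * S' = 1 := by
      rw [← Matrix.mul_assoc, hP, Matrix.one_mul, hS]
    rwa [hC] at this
  refine le_antisymm ?_ ?_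
  · conv_lhs => rw [← hC, Matrix.map_mul]
    exact (Matrix.rank_mul_le_left _ _).trans 
      ((Matrix.rank_le_card_width _).trans_eq (Fintype.card_fin _))
  · have h2 : P'.map (algebraMap K R) * C.map (algebraMap K R) * S'.map (algebraMap K R) = 1 := by
      rw [← Matrix.map_mul, ← Matrix.map_mul, h1, Matrix.map_one _ (map_zero _) (map_one _)]
    calc C.rank = (1 : Matrix (Fin C.rank) (Fin C.rank) R).rank := by
          rw [Matrix.rank_one, Fintype.card_fin]
      _ ≤ _ := by
          rw [← h2]
          exact (Matrix.rank_mul_le_left _ _).trans (Matrix.rank_mul_le_right _ _)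

end Rank

/-! ### Gluing strands: complex and exactness -/

section Exactness

variable {K : Type u} [Field K] {n e : ℕ} {E : Type v} [AddCommGroup E] [Module (Poly K n) E]
  {G : Type w} [AddCommGroup G] [Module (Poly K n) G] {bE : FreeMultigraded K n e E}
  {φ : E →ₗ[Poly K n] G}

/-- Lifts chosen degree by degree must be zero in almost all degrees to come from an element of the
module, so 0 is chosen wherever the target vanishes. -/
lemma exists_finsupp_lift {ι X Y : Type*} [AddCommGroup X] [AddCommGroup Y]
    (T : X →+ Y) (P : ι → AddSubgroup X) (q : ι → Y) (hq : {a | q a ≠ 0}.Finite)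
    (h : ∀ a, ∃ x ∈ P a, T x = q a) : ∃ w : ι →₀ X, ∀ a, w a ∈ P a ∧ T (w a) = q a := by
  classical
  choose x hx hT using h
  refine ⟨Finsupp.onFinset hq.toFinset (fun a => if q a = 0 then 0 else x a) fun a ha => ?_,
    fun a => ?_⟩
  · rw [Set.Finite.mem_toFinset]
    exact fun h => ha (if_pos h)
  · rw [Finsupp.onFinset_apply]
    split_ifs with h
    · exact ⟨zero_mem _, by rw [map_zero, h]⟩
    · exact ⟨hx a, hT a⟩

variable {V : Type*} [AddCommGroup V] [Module K V] [FiniteDimensional K V] {r : ℕ}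
  {s : (Fin e → K) →ₗ[K] V}

lemma nonempty_extDual_equiv (hr : Module.finrank K V = r) : Nonempty (ExtDual K V r ≃ₗ[K] K) :=
  ⟨LinearEquiv.ofFinrankEq _ _ (by
    rw [exteriorPower.finrank_eq, Subspace.dual_finrank_eq, hr, Nat.choose_self,
      Module.finrank_self])⟩

lemma fullSystem_isComplex
    (hφ : ∀ z, φ z = 0 ↔ ∀ a, ∑ l, basisStrand bE a z l • s (Pi.single l 1) = 0)
    (hr : Module.finrank K V = r) :
    (fullSystem s r).IsComplex bE φ := by
  obtain ⟨θ⟩ := nonempty_extDual_equiv hr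
  have b := Module.finBasisOfFinrankEq K _ hr
  refine ⟨LinearMap.ext fun z => ?_, LinearMap.ext fun z => ?_, fun p => LinearMap.ext fun z => ?_⟩
  · rw [LinearMap.comp_apply, LinearMap.zero_apply, hφ]
    intro a
    rw [basisStrand_dTwo (θ := θ)]
    exact sum_splice_smul b _
  · rw [LinearMap.comp_apply, LinearMap.zero_apply]
    refine basisStrand_injective (bE := bE) fun a => ?_
    rw [basisStrand_dTwo (θ := θ), strand_d, splice_divKoszul b, basisStrand_zero]
  · rw [LinearMap.comp_apply, LinearMap.zero_apply]
    refine strand_injective (θ := θ) (deg := bE.deg) fun a => ?_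
    rw [strand_d, strand_d, divKoszul_divKoszul, strand_zero]

lemma fullSystem_isExact_iff
    (hφ : ∀ z, φ z = 0 ↔ ∀ a, ∑ l, basisStrand bE a z l • s (Pi.single l 1) = 0)
    (hr : Module.finrank K V = r) :
    (fullSystem s r).IsExact bE φ ↔ ∀ a : Fin n →₀ ℕ,
      Module.finrank K (Submodule.span K ((fun l => s (Pi.single l 1)) '' verticesLE bE.deg a)) =
        min r (verticesLE bE.deg a).card := by
  obtain ⟨θ⟩ := nonempty_extDual_equiv hr
  have b := Module.finBasisOfFinrankEq K _ hr
  have hψ := volumeForm_ne_zero b θ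
  obtain ⟨hc1, hc2, hc3⟩ := fullSystem_isComplex hφ hr
  have hd : ∀ (p : ℕ) (a : Fin n →₀ ℕ)
      (z : (fullSystem s r).Term n (p + 1)),
      strand θ bE.deg a ((fullSystem s r).d bE.deg p z) =
        divKoszul (fun l => s (Pi.single l 1)) p (strand θ bE.deg a z) := fun p a z => strand_d a z
  have hd2 : ∀ (a : Fin n →₀ ℕ) (z : (fullSystem s r).Term n 0),
      basisStrand bE a ((fullSystem s r).dTwo bE z) =
        splice (volumeForm θ) (fun l => s (Pi.single l 1)) (strand θ bE.deg a z) :=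
    fun a z => basisStrand_dTwo bE a z
  constructor
  · rintro ⟨hE, -⟩ a
    refine finrank_span_eq_min (ψ := volumeForm θ) hr fun u hu hsum => ?_
    -- The relation u is homogenised to an element of E concentrated in degree a, to which exactness
    -- at E applies.
    obtain ⟨x, hxa, hx⟩ := exists_basisStrand_eq bE a fun l hl => hu l (mt mem_verticesLE.1 hl)
    have hφx : φ x = 0 := (hφ x).2 fun a' => by
      rcases eq_or_ne a' a with rfl | hne
      · rwa [hxa]
      · rw [hx a' hne]; simp
    obtain ⟨z, rfl⟩ := (hE x).1 hφx
    exact ⟨strand θ bE.deg a z, strand_mem_supported a z, by rw [← hd2, hxa]⟩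
  · intro H
    refine ⟨fun x => ⟨fun hx => ?_, ?_⟩, fun x => ⟨fun hx => ?_, ?_⟩,
      fun p x => ⟨fun hx => ?_, ?_⟩⟩
    · obtain ⟨w, hw⟩ := exists_finsupp_lift
        (splice (volumeForm θ) (fun l => s (Pi.single l 1))).toAddMonoidHom
        (fun a => (supported K _ (verticesLE bE.deg a) (r + 1)).toAddSubgroup)
        (fun a => basisStrand bE a x) (finite_basisStrand_ne_zero bE x) fun a =>
          exists_splice_eq_of_finrank hr hψ (H a)
            (fun l hl => basisStrand_of_not_le (fun h => hl (mem_verticesLE.2 h)) x)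
            ((hφ x).1 hx a)
      obtain ⟨z, hz⟩ := exists_strand_eq (s := s) (θ := θ) w fun a => (hw a).1
      exact ⟨z, basisStrand_injective fun a => by rw [hd2, hz]; exact (hw a).2⟩
    · rintro ⟨z, rfl⟩
      exact LinearMap.congr_fun hc1 z
    · obtain ⟨w, hw⟩ := exists_finsupp_lift
        (divKoszul (fun l => s (Pi.single l 1)) 0).toAddMonoidHom
        (fun a => (supported K _ (verticesLE bE.deg a) (r + 1 + 1)).toAddSubgroup)
        (fun a => strand θ bE.deg a x) (finite_strand_ne_zero x) fun a =>
          splice_exact_of_finrank hr hψ (H a) (strand_mem_supported a x)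
            (by rw [← hd2, hx, basisStrand_zero])
      obtain ⟨z, hz⟩ := exists_strand_eq (s := s) (θ := θ) w fun a => (hw a).1
      exact ⟨z, strand_injective fun a => by rw [hd, hz]; exact (hw a).2⟩
    · rintro ⟨z, rfl⟩
      exact LinearMap.congr_fun hc2 z
    · obtain ⟨w, hw⟩ := exists_finsupp_lift
        (divKoszul (fun l => s (Pi.single l 1)) (p + 1)).toAddMonoidHom
        (fun a => (supported K _ (verticesLE bE.deg a) (r + 1 + (p + 1 + 1))).toAddSubgroup)
        (fun a => strand θ bE.deg a x) (finite_strand_ne_zero x) fun a =>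
          divKoszul_exact_of_finrank hr (H a) (strand_mem_supported a x) (by
            rw [← hd, hx]
            exact strand_zero a)
      obtain ⟨z, hz⟩ := exists_strand_eq (s := s) (θ := θ) w fun a => (hw a).1
      exact ⟨z, strand_injective fun a => by rw [hd, hz]; exact (hw a).2⟩
    · rintro ⟨z, rfl⟩
      exact LinearMap.congr_fun (hc3 p) z

end Exactness

/-! ### From the multigraded map to its coefficient matrix -/

section Main

variable {K : Type u} [Field K] {n e g : ℕ} {E : Type v} [AddCommGroup E] [Module (Poly K n) E]
  {G : Type w} [AddCommGroup G] [Module (Poly K n) G] {bE : FreeMultigraded K n e E}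
  {bG : FreeMultigraded K n g G} {φ : E →ₗ[Poly K n] G}

lemma IsMultigraded.add_deg_eq (hφ : IsMultigraded bE bG φ) {i : Fin g} {j : Fin e}
    {ν : Fin n →₀ ℕ} (h : (bG.basis.repr (φ (bE.basis j)) i).coeff ν ≠ 0) :
    ν + bG.deg i = bE.deg j := by
  refine hφ (bE.deg j) (bE.basis j) ?_ i ν (MvPolynomial.mem_support_iff.2 h)
  intro j' ν' hν'
  rw [Module.Basis.repr_self] at hν'
  rcases eq_or_ne j' j with rfl | hne
  · rw [Finsupp.single_eq_same, MvPolynomial.mem_support_iff, MvPolynomial.coeff_one] at hν'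
    rw [← (ite_ne_right_iff.1 hν').1, zero_add]
  · rw [Finsupp.single_eq_of_ne hne] at hν'
    simp at hν'

lemma IsMultigraded.deg_le (hφ : IsMultigraded bE bG φ) {i : Fin g} {j : Fin e}
    (h : coeffMatrix bE bG φ i j ≠ 0) : bG.deg i ≤ bE.deg j :=
  hφ.add_deg_eq h ▸ le_add_self

lemma IsMultigraded.repr_apply_basis (hφ : IsMultigraded bE bG φ) (i : Fin g) (j : Fin e) :
    bG.basis.repr (φ (bE.basis j)) i =
      MvPolynomial.monomial (bE.deg j - bG.deg i) (coeffMatrix bE bG φ i j) := by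
  ext ν
  rw [MvPolynomial.coeff_monomial]
  split_ifs with h
  · rw [← h]; rfl
  · by_contra h'
    exact h (by rw [← hφ.add_deg_eq h', add_tsub_cancel_right])

/-- Multiplying by diagonal matrices of monomials, which are injective over Q, turns the matrix of φ
into that of C. -/
lemma IsMultigraded.mapRank_eq (hφ : IsMultigraded bE bG φ) :
    mapRank φ = (coeffMatrix bE bG φ).rank := by
  classical
  set C := coeffMatrix bE bG φ
  let M := LinearMap.toMatrix bE.basis bG.basis φ
  have hM : mapRank φ = M.rank := by
    rw [Matrix.rank_eq_finrank_range_toLin M bG.basis bE.basis, Matrix.toLin_toMatrix]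
    rfl
  -- A common bound for all degrees, so that the exponents below are honest differences.
  let a : Fin n →₀ ℕ := Finset.univ.sup bE.deg ⊔ Finset.univ.sup bG.deg
  have hE : ∀ j, bE.deg j ≤ a := fun j => (Finset.le_sup (Finset.mem_univ j)).trans le_sup_left
  have hG : ∀ i, bG.deg i ≤ a := fun i => (Finset.le_sup (Finset.mem_univ i)).trans le_sup_right
  let DE : Matrix (Fin e) (Fin e) (Poly K n) :=
    Matrix.diagonal fun j => MvPolynomial.monomial (a - bE.deg j) 1
  let DG : Matrix (Fin g) (Fin g) (Poly K n) :=
    Matrix.diagonal fun i => MvPolynomial.monomial (a - bG.deg i) 1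
  have hDE : DE.det ≠ 0 := by
    rw [Matrix.det_diagonal, Finset.prod_ne_zero_iff]
    simp
  have hDG : DG.det ≠ 0 := by
    rw [Matrix.det_diagonal, Finset.prod_ne_zero_iff]
    simp
  have hMij : ∀ i j, M i j = bG.basis.repr (φ (bE.basis j)) i :=
    LinearMap.toMatrix_apply bE.basis bG.basis φ
  have key : M * DE = DG * C.map (algebraMap K (Poly K n)) := by
    ext1 i j
    rw [Matrix.mul_diagonal, Matrix.diagonal_mul, hMij, hφ.repr_apply_basis,
      Matrix.map_apply, MvPolynomial.algebraMap_eq, MvPolynomial.monomial_mul,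
      mul_comm _ (MvPolynomial.C _), MvPolynomial.C_mul_monomial]
    by_cases h : C i j = 0
    · rw [show coeffMatrix bE bG φ i j = 0 from h, h]; simp
    · rw [add_comm, tsub_add_tsub_cancel (hE j) (hφ.deg_le h)]
  rw [hM, ← Matrix.rank_mul_eq_left_of_det_ne_zero DE M hDE, key,
    Matrix.rank_mul_eq_right_of_det_ne_zero DG _ hDG, Matrix.rank_map_algebraMap]

lemma IsMultigraded.coeff_repr_apply (hφ : IsMultigraded bE bG φ) (z : E) (i : Fin g)
    (ν : Fin n →₀ ℕ) :
    (bG.basis.repr (φ z) i).coeff ν =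
      (coeffMatrix bE bG φ).mulVec (basisStrand bE (ν + bG.deg i) z) i := by
  conv_lhs => rw [← bE.basis.sum_repr z]
  simp only [map_sum, map_smul, Finsupp.finsetSum_apply, Finsupp.smul_apply, smul_eq_mul,
    hφ.repr_apply_basis, MvPolynomial.coeff_sum, Matrix.mulVec, dotProduct]
  refine Finset.sum_congr rfl fun j _ => ?_
  by_cases h : coeffMatrix bE bG φ i j = 0
  · rw [h]; simp
  have hle := hφ.deg_le h
  rw [MvPolynomial.coeff_mul_monomial']
  split_ifs with h1
  · rw [basisStrand_of_le (tsub_le_iff_right.1 h1), mul_comm]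
    congr 2
    rw [← add_tsub_add_eq_tsub_right ν (bG.deg i), tsub_add_cancel_of_le hle]
  · rw [basisStrand_of_not_le (fun h2 => h1 (tsub_le_iff_right.2 h2)), mul_zero]

lemma IsMultigraded.apply_eq_zero_iff (hφ : IsMultigraded bE bG φ) (z : E) :
    φ z = 0 ↔ ∀ a, (coeffMatrix bE bG φ).mulVec (basisStrand bE a z) = 0 := by
  constructor
  · intro h a
    ext i
    by_cases hi : bG.deg i ≤ a
    · rw [← tsub_add_cancel_of_le hi, ← hφ.coeff_repr_apply, h]
      simp
    · rw [Pi.zero_apply, Matrix.mulVec, dotProduct]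
      -- When |g_i| ≰ a, row i has only zeros in the columns of degree at most a.
      refine Finset.sum_eq_zero fun j _ => ?_
      by_cases hC : coeffMatrix bE bG φ i j = 0
      · rw [hC, zero_mul]
      · rw [basisStrand_of_not_le fun h => hi ((hφ.deg_le hC).trans h), mul_zero]
  · intro h
    apply bG.basis.repr.injective
    ext i ν
    rw [hφ.coeff_repr_apply, h]
    simp

/-- The columns of the coefficient matrix as vectors of its column space. -/
def column (bE : FreeMultigraded K n e E) (bG : FreeMultigraded K n g G)
    (φ : E →ₗ[Poly K n] G) (l : Fin e) : LinearMap.range (coeffMatrix bE bG φ).mulVecLin :=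
  coeffMap bE bG φ (Pi.single l 1)

lemma sum_smul_column_eq_zero_iff (u : Fin e → K) :
    ∑ l, u l • column bE bG φ l = 0 ↔ (coeffMatrix bE bG φ).mulVec u = 0 := by
  have : ∑ l, u l • column bE bG φ l = coeffMap bE bG φ u := by
    simp only [column, ← map_smul, ← map_sum]
    congr 1
    ext l
    simp [Finset.sum_apply, Pi.single_apply]
  rw [this, ← Submodule.coe_eq_zero]
  rfl

/-- The inclusion of V in W preserves the dimension of the span of the columns. -/
lemma rank_coeffMatrixLE (a : Fin n →₀ ℕ) : (coeffMatrixLE bE bG φ a).rank =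
    Module.finrank K (Submodule.span K (column bE bG φ '' verticesLE bE.deg a)) := by
  rw [Matrix.rank_eq_finrank_span_cols, ← Submodule.finrank_map_subtype_eq, Submodule.map_span]
  suffices Set.range (coeffMatrixLE bE bG φ a).col = (LinearMap.range
      (coeffMatrix bE bG φ).mulVecLin).subtype '' (column bE bG φ '' verticesLE bE.deg a) by
    rw [this]
  ext v
  constructor
  · rintro ⟨⟨j, hj⟩, rfl⟩
    refine ⟨_, ⟨j, mem_verticesLE.2 hj, rfl⟩, ?_⟩
    ext i
    simp [column, coeffMap, coeffMatrixLE]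
  · rintro ⟨_, ⟨j, hj, rfl⟩, rfl⟩
    refine ⟨⟨j, mem_verticesLE.1 hj⟩, ?_⟩
    ext i
    simp [column, coeffMap, coeffMatrixLE]

end Main

end BRT

end

theorem theorem4p5 {K : Type*} [Field K] {n e g : ℕ}
    {E : Type*} [AddCommGroup E] [Module (BRT.Poly K n) E]
    {G : Type*} [AddCommGroup G] [Module (BRT.Poly K n) G]
    (bE : BRT.FreeMultigraded K n e E) (bG : BRT.FreeMultigraded K n g G)
    (φ : E →ₗ[BRT.Poly K n] G) (hφ : BRT.IsMultigraded bE bG φ) :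
    (BRT.taylor bE bG φ).IsComplex bE φ ∧
    ((BRT.taylor bE bG φ).IsExact bE φ ↔
      ∀ a : Fin n →₀ ℕ, (BRT.coeffMatrixLE bE bG φ a).rank =
        min (BRT.mapRank φ) (Fintype.card {j : Fin e // bE.deg j ≤ a})) := by
  have hr : Module.finrank K (LinearMap.range (BRT.coeffMatrix bE bG φ).mulVecLin) =
      BRT.mapRank φ := hφ.mapRank_eq.symm
  have hs := fun z => (hφ.apply_eq_zero_iff z).trans
    (forall_congr' fun a => (BRT.sum_smul_column_eq_zero_iff (bG := bG) (φ := φ) _).symm)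
  refine ⟨BRT.fullSystem_isComplex hs hr, (BRT.fullSystem_isExact_iff hs hr).trans ?_⟩
  refine forall_congr' fun a => ?_
  rw [BRT.rank_coeffMatrixLE, Fintype.card_of_subtype (BRT.verticesLE bE.deg a)
    fun j => BRT.mem_verticesLE]
  rfl
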